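/- Let $k\ge 1$ be an integer, let $V=\{0,\dots,k\}$, and let $R,S_1,\dots,S_k,T$ be pairwise distinct predicates, $R,T$ unary and $S_1,\dots,S_k$ binary. Put $h_{k,0}=\exists x\exists y\,(R(x)\wedge S_1(x,y))$, $h_{k,i}=\exists x\exists y\,(S_i(x,y)\wedge S_{i+1}(x,y))$ for $1\le i<k$, and $h_{k,k}=\exists x\exists y\,(S_k(x,y)\wedge T(y))$. For a Boolean function $\varphi:2^V\to\{0,1\}$, let $Q_\varphi$ be the Boolean query obtained from $\varphi$ by replacing each variable $i\in V$ by $h_{k,i}$, and let $\mathrm{eul}(\varphi)=\sum_{\nu\subseteq V,\ \varphi(\nu)=1}(-1)^{|\nu|}$. For a Boolean query $Q$, $\mathrm{PQE}(Q)$ is the following problem: given a finite database $D$ over $R,S_1,\dots,S_k,T$ and rational probabilities $\pi(t)\in[0,1]$ for $t\in D$, compute $$\sum_{D'\subseteq D,\ D'\models Q}\ \prod_{t\in D'}\pi(t)\prod_{t\in D\setminus D'}(1-\pi(t)).$$ The lineage of $Q$ on $D$ is the Boolean function on the set of variables $D$ that maps $D'\subseteq D$ to true iff $D'\models Q$. A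 d-D is a Boolean circuit with variable gates, $\neg$-gates, and $\wedge$- and $\vee$-gates of unbounded (possibly zero) fan-in, in which distinct inputs of an $\wedge$-gate depend on disjoint sets of variables (there is a directed path to them from variable gates of disjoint sets of variables) and distinct inputs of an $\vee$-gate capture Boolean functions that are never true simultaneously. We say that $Q$ has d-Ds computable in PTIME if some polynomial-time algorithm maps every database $D$ to a d-D that represents the lineage of $Q$ on $D$, and that $Q$ has polynomial-size d-Ds if there is a polynomial $b$ such that, for every database $D$, the lineage of $Q$ on $D$ is represented by some d-D with at most $b(|D|)$ gates and wires in total. **Theorem.** Let $\varphi,\varphi'$ be Boolean functions on $V$ (not necessarily monotone) with $\mathrm{eul}(\varphi)=\mathrm{eul}(\varphi')$. Then: (a) $\mathrm{PQE}(Q_\varphi)$ and $\mathrm{PQE}(Q_{\varphi'})$ are equivalent under polynomial-time Turing reductions; (b) $Q_\varphi$ has d-Ds computable in PTIME if and only if $Q_{\varphi'}$ does; (c) $Q_\varphi$ has polynomial-size d-Ds if and only if $Q_{\varphi'}$ does. Here complexity is data complexity: $k$, $\varphi$ and $\varphi'$ are fixed. -/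

import Mathlib

namespace HQ

/-! ### Boolean functions and the Euler characteristic -/

/-- A Boolean function on `V`: it maps each valuation (a subset of `V`) to a truth value. -/
abbrev BoolFun (V : Type) := Finset V → Bool

/-- The Euler characteristic: the sum of `(-1) ^ |ν|` over the satisfying valuations `ν`. -/
def eul {V : Type} [Fintype V] [DecidableEq V] (φ : BoolFun V) : ℤ :=
  ∑ ν : Finset V with φ ν = true, (-1) ^ ν.card

/-! ### Databases, Boolean queries and the queries `Q_φ` -/

/-- Facts over the signature `R, S₁, …, S_k, T`, with constants in `ℕ`.
The predicate `S_{j+1}` is written `S j`, for `j = 0, …, k - 1`. -/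
inductive Fact (k : ℕ) where
  | R (a : ℕ)
  | S (j : Fin k) (a b : ℕ)
  | T (a : ℕ)
  deriving DecidableEq

/-- A relational instance: a finite set of facts. -/
abbrev Database (k : ℕ) := Finset (Fact k)

/-- A Boolean query: the property of databases that it expresses. -/
abbrev BoolQuery (k : ℕ) := Database k → Prop

/-- First atom of `h_{k,i}`: `R(x)` if `i = 0`, and `S_i(x,y)` if `1 ≤ i ≤ k`. -/
def firstAtom {k : ℕ} (i : Fin (k + 1)) (x y : ℕ) : Fact k :=
  Fin.cases (Fact.R x) (fun j => Fact.S j x y) i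

/-- Second atom of `h_{k,i}`: `S_{i+1}(x,y)` if `0 ≤ i < k`, and `T(y)` if `i = k`. -/
def secondAtom {k : ℕ} (i : Fin (k + 1)) (x y : ℕ) : Fact k :=
  Fin.lastCases (Fact.T y) (fun j => Fact.S j x y) i

/-- The conjunctive query `h_{k,i}`. -/
def hk {k : ℕ} (i : Fin (k + 1)) : BoolQuery k :=
  fun D => ∃ x y : ℕ, firstAtom i x y ∈ D ∧ secondAtom i x y ∈ D

open Classical in
/-- The query `Q_φ`, that is, `φ` with each variable `i` replaced by `h_{k,i}`. -/
def hQuery {k : ℕ} (φ : BoolFun (Fin (k + 1))) : BoolQuery k :=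
  fun D => φ {i | hk i D} = true

/-! ### Tuple-independent databases -/

/-- A tuple-independent database `(D, π)`; the values of `π` outside `D` play no role. -/
structure TID (k : ℕ) where
  D : Database k
  π : Fact k → ℚ
  nonneg : ∀ t ∈ D, 0 ≤ π t
  le_one : ∀ t ∈ D, π t ≤ 1

/-- The probability of the sub-database `D'` of `I.D`. -/
def TID.worldProb {k : ℕ} (I : TID k) (D' : Database k) : ℚ :=
  (∏ t ∈ D', I.π t) * ∏ t ∈ I.D \ D', (1 - I.π t)

open Classical in
/-- The probability that `Q` is satisfied. -/
noncomputable def TID.prob {k : ℕ} (I : TID k) (Q : BoolQuery k) : ℚ :=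
  ∑ D' ∈ I.D.powerset with Q D', I.worldProb D'

/-! ### Boolean circuits and d-Ds -/

/-- Gates of a circuit with variables in `α`; inputs are designated by gate numbers. Fan-in is
unbounded; `and []` and `or []` are the constants. -/
inductive Gate (α : Type) where
  | var (t : α)
  | not (j : ℕ)
  | and (js : List ℕ)
  | or (js : List ℕ)

/-- The input gates of a gate. -/
def Gate.inputs {α : Type} : Gate α → List ℕ
  | .var _ => []
  | .not j => [j]
  | .and js => js
  | .or js => js

/-- A circuit: its gates, listed in a topological order and numbered from `0`, and the number of
its output gate. -/
structure Circuit (α : Type) where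
  gates : List (Gate α)
  out : ℕ

namespace Circuit

variable {α : Type}

/-- The output gate exists, and every wire goes from a gate to a later one. -/
def WellFormed (C : Circuit α) : Prop :=
  C.out < C.gates.length ∧ ∀ (i : ℕ) (g : Gate α), C.gates[i]? = some g → ∀ j ∈ g.inputs, j < i

/-- Number of gates plus number of wires. -/
def size (C : Circuit α) : ℕ :=
  (C.gates.map fun g => 1 + g.inputs.length).sum

/-- The value of gate `i` under the valuation `ν`. (In a well-formed circuit the tests `j < i`
always succeed.) -/
def eval [DecidableEq α] (C : Circuit α) (ν : Finset α) (i : ℕ) : Bool :=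
  match C.gates[i]? with
  | none => false
  | some (.var t) => decide (t ∈ ν)
  | some (.not j) => if _h : j < i then !(eval C ν j) else false
  | some (.and js) => js.all fun j => if _h : j < i then eval C ν j else false
  | some (.or js) => js.any fun j => if _h : j < i then eval C ν j else false
termination_by i

/-- `C.HasVar i t`: a variable gate labelled `t` has a directed path to gate `i`. -/
inductive HasVar (C : Circuit α) : ℕ → α → Prop
  | var {i : ℕ} {t : α} : C.gates[i]? = some (.var t) → HasVar C i t
  | wire {i j : ℕ} {g : Gate α} {t : α} :
      C.gates[i]? = some g → j ∈ g.inputs → HasVar C j t → HasVar C i t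

/-- Distinct inputs of an `∧`-gate depend on disjoint sets of variables. -/
def Decomposable (C : Circuit α) : Prop :=
  ∀ (i : ℕ) (js : List ℕ), C.gates[i]? = some (.and js) → ∀ j₁ ∈ js, ∀ j₂ ∈ js, j₁ ≠ j₂ →
    ∀ t, ¬ (C.HasVar j₁ t ∧ C.HasVar j₂ t)

/-- Distinct inputs of an `∨`-gate capture disjoint Boolean functions. -/
def Deterministic [DecidableEq α] (C : Circuit α) : Prop :=
  ∀ (i : ℕ) (js : List ℕ), C.gates[i]? = some (.or js) → ∀ j₁ ∈ js, ∀ j₂ ∈ js, j₁ ≠ j₂ →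
    ∀ ν : Finset α, ¬ (C.eval ν j₁ = true ∧ C.eval ν j₂ = true)

/-- Deterministic decomposable circuits. -/
def IsDD [DecidableEq α] (C : Circuit α) : Prop :=
  C.WellFormed ∧ C.Decomposable ∧ C.Deterministic

/-- `C` is a circuit over the facts of `D` which captures the lineage of `Q` on `D`, the Boolean
function that maps `D' ⊆ D` to true if and only if `D'` satisfies `Q`. -/
def RepresentsLineage {k : ℕ} (C : Circuit (Fact k)) (Q : BoolQuery k) (D : Database k) : Prop :=
  (∀ t, Gate.var t ∈ C.gates → t ∈ D) ∧ ∀ D' ⊆ D, (C.eval D' C.out = true ↔ Q D')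

end Circuit

/-! ### Programs with an oracle, and their running time

Programs manipulate finite binary trees whose leaves are natural numbers written in binary.
Every executed operation is charged the number of bits and nodes of its input and of its output
(logarithmic cost), so that running times agree with those of (oracle) Turing machines up to a
polynomial. -/

inductive Val where
  | nat (n : ℕ)
  | pair (a b : Val)
  deriving DecidableEq

namespace Val

/-- Length of a value: number of nodes, plus the lengths of the binary expansions at the leaves. -/
def size : Val → ℕ
  | nat n => Nat.size n + 1
  | pair a b => a.size + b.size + 1

def fst : Val → Val
  | nat _ => nat 0
  | pair a _ => a

def snd : Val → Val
  | nat _ => nat 0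
  | pair _ b => b

/-- A binary operation on numbers, applied to a pair of leaves (and `0` on other values). -/
def arith (f : ℕ → ℕ → ℕ) : Val → Val
  | pair (nat a) (nat b) => nat (f a b)
  | _ => nat 0

/-- Equality test for the two components of a pair. -/
def eqTest (x : Val) : Val := if x.fst = x.snd then nat 1 else nat 0

end Val

/-- Basic operations, each performed by one instruction. -/
inductive Op where
  | id
  | const (v : Val)
  | fst
  | snd
  | add
  | sub
  | mul
  | div
  | eq

def Op.apply : Op → Val → Val
  | .id, x => x
  | .const v, _ => v
  | .fst, x => x.fst
  | .snd, x => x.snd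
  | .add, x => x.arith (· + ·)
  | .sub, x => x.arith (· - ·)
  | .mul, x => x.arith (· * ·)
  | .div, x => x.arith (· / ·)
  | .eq, x => x.eqTest

/-- Programs transforming a value:
a basic operation; a call of the oracle on the current value; `pair p q`, which runs `p` and `q` on
the current value and pairs the results; `seq p q`, which runs `p` and then `q`; `ite c p q`, which
runs `p` if the result of `c` is not the leaf `0` and `q` otherwise; `loop p`, which repeats `p` as
long as the first component of the current value is not the leaf `0`. -/
inductive Prog where
  | op (o : Op)
  | oracle
  | pair (p q : Prog)
  | seq (p q : Prog)
  | ite (c p q : Prog)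
  | loop (p : Prog)

/-- `Runs O p x y t`: with oracle `O`, the program `p` started on `x` halts with result `y`, at
cost `t`. -/
inductive Runs (O : Val → Val) : Prog → Val → Val → ℕ → Prop
  | op (o : Op) (x : Val) : Runs O (.op o) x (o.apply x) (x.size + (o.apply x).size)
  | oracle (x : Val) : Runs O .oracle x (O x) (x.size + (O x).size)
  | pair {p q : Prog} {x y z : Val} {s t : ℕ} :
      Runs O p x y s → Runs O q x z t →
      Runs O (.pair p q) x (.pair y z) (s + t + x.size + (Val.pair y z).size)
  | seq {p q : Prog} {x y z : Val} {s t : ℕ} :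
      Runs O p x y s → Runs O q y z t → Runs O (.seq p q) x z (s + t + x.size + z.size)
  | ite_true {c p q : Prog} {x b y : Val} {s t : ℕ} :
      Runs O c x b s → b ≠ .nat 0 → Runs O p x y t →
      Runs O (.ite c p q) x y (s + t + x.size + y.size)
  | ite_false {c p q : Prog} {x y : Val} {s t : ℕ} :
      Runs O c x (.nat 0) s → Runs O q x y t →
      Runs O (.ite c p q) x y (s + t + x.size + y.size)
  | loop_done {p : Prog} {x : Val} :
      x.fst = .nat 0 → Runs O (.loop p) x x (x.size + x.size)
  | loop_step {p : Prog} {x y z : Val} {s t : ℕ} :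
      x.fst ≠ .nat 0 → Runs O p x y s → Runs O (.loop p) y z t →
      Runs O (.loop p) x z (s + t + x.size + z.size)

/-- A program without access to an oracle: the oracle always answers `0`. -/
def noOracle : Val → Val := fun _ => .nat 0

/-- A computational problem that asks for a value, given by its graph: `P x y` says that `x` is an
instance and that `y` is the answer to it. -/
abbrev Problem := Val → Val → Prop

/-- Polynomial-time Turing reducibility `P ≤_T P'`: some program solves `P` in polynomial time when
given any oracle that answers the instances of `P'` correctly. -/
def TuringReducible (P P' : Problem) : Prop :=
  ∃ (p : Prog) (b : Polynomial ℕ), ∀ O : Val → Val, (∀ x y, P' x y → O x = y) →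
    ∀ x y, P x y → ∃ t ≤ b.eval x.size, Runs O p x y t

/-- Polynomial-time Turing equivalence `P ≡_T P'`. -/
def TuringEquivalent (P P' : Problem) : Prop :=
  TuringReducible P P' ∧ TuringReducible P' P

/-! ### Encodings -/

def encList : List Val → Val
  | [] => .nat 0
  | v :: l => .pair v (encList l)

def encFact {k : ℕ} : Fact k → Val
  | .R a => .pair (.nat 0) (.nat a)
  | .S j a b => .pair (.nat 1) (.pair (.nat j) (.pair (.nat a) (.nat b)))
  | .T a => .pair (.nat 2) (.nat a)

/-- An integer `z` is coded by the pair of its positive and negative parts. -/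
def encInt (z : ℤ) : Val := .pair (.nat z.toNat) (.nat (-z).toNat)

/-- A rational number is coded by its numerator and denominator, in lowest terms. -/
def encRat (q : ℚ) : Val := .pair (encInt q.num) (.nat q.den)

/-- The list `l` enumerates the facts of `D` without repetition. -/
def Lists {k : ℕ} (l : List (Fact k)) (D : Database k) : Prop :=
  l.Nodup ∧ l.toFinset = D

def encFacts {k : ℕ} (l : List (Fact k)) : Val := encList (l.map encFact)

/-- Facts together with their probabilities. -/
def encTID {k : ℕ} (l : List (Fact k)) (π : Fact k → ℚ) : Val :=
  encList (l.map fun t => .pair (encFact t) (encRat (π t)))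

def encGate {k : ℕ} : Gate (Fact k) → Val
  | .var t => .pair (.nat 0) (encFact t)
  | .not j => .pair (.nat 1) (.nat j)
  | .and js => .pair (.nat 2) (encList (js.map .nat))
  | .or js => .pair (.nat 3) (encList (js.map .nat))

def encCircuit {k : ℕ} (C : Circuit (Fact k)) : Val :=
  .pair (encList (C.gates.map encGate)) (.nat C.out)

/-! ### The problem `PQE(Q)` and the classes `d-D(PTIME)` and `d-D(PSIZE)` -/

/-- Probabilistic query evaluation for `Q`: given a tuple-independent database, its facts being
listed in any order, compute the probability that `Q` is satisfied. -/
def PQE {k : ℕ} (Q : BoolQuery k) : Problem :=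
  fun x y => ∃ (I : TID k) (l : List (Fact k)),
    Lists l I.D ∧ x = encTID l I.π ∧ y = encRat (I.prob Q)

/-- `Q ∈ d-D(PTIME)`: given a database, its facts being listed in any order, a d-D that represents
the lineage of `Q` can be computed in polynomial time. -/
def DDPtime {k : ℕ} (Q : BoolQuery k) : Prop :=
  ∃ (p : Prog) (b : Polynomial ℕ), ∀ (D : Database k) (l : List (Fact k)), Lists l D →
    ∃ C : Circuit (Fact k), C.IsDD ∧ C.RepresentsLineage Q D ∧
      ∃ t ≤ b.eval (encFacts l).size, Runs noOracle p (encFacts l) (encCircuit C) t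

/-- `Q ∈ d-D(PSIZE)`: the lineage of `Q` on any database has a d-D of size polynomial in the number
of facts. -/
def DDPsize {k : ℕ} (Q : BoolQuery k) : Prop :=
  ∃ b : Polynomial ℕ, ∀ D : Database k,
    ∃ C : Circuit (Fact k), C.IsDD ∧ C.RepresentsLineage Q D ∧ C.size ≤ b.eval D.card

end HQ

/-! Call two valuations adjacent if they differ in one variable. A move negates a Boolean function
at two adjacent valuations where its values agree. Adjacent valuations have opposite signs, so moves
preserve `eul`. Conversely, if `eul φ = eul φ'`, the valuations where `φ` and `φ'` differ split into
pairs whose contributions cancel, and such a pair can be negated by moves along a path of the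
hypercube that joins it (`toggle_pair_induction`, `eul_toggle_induction`). A move that deletes a
pair is, up to complement, a move that adds one. So a class of functions that is closed under
complement and under the addition of adjacent pairs depends only on `eul` (`eul_induction`).

Adding `ν` and `ν ∪ {i}` means taking the disjunction with a query that excludes the old one and
constrains only the `h_{k,j}` with `j ≠ i`. Without `h_{k,i}` the chain `R, S_1, …, S_k, T` breaks
between its two sides. The facts of `R, S_1, …, S_i` are grouped by first constant, and those of
`S_{i+1}, …, S_k, T` by second constant. An automaton that remembers the last unary and the last
binary fact then detects every match of the remaining `h_{k,j}` (`State.mem_run_factOrder`). It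
reads each fact once and its number of states depends on `k` alone. Unrolling it by Shannon
expansion gives a d-D of polynomial size (`captures_automatonGates`); dynamic programming over its
states gives the probability (`table_correct`).

`eul_induction` is applied to three classes: functions with polynomial-size d-Ds, functions with
d-Ds computable in polynomial time, and functions whose query probability is computable in
polynomial time with every oracle that is correct for `φ`. The last class contains `φ` because the
oracle can be called, and membership of `φ'` is the desired reduction. Running times are handled by
the closure properties of `PT`. -/

namespace HQ

/-! ### Polynomial-time functions between encoded types -/

/-- A type whose elements are coded by values. -/
class Enc (A : Type) where
  enc : A → Val

open Enc

section Framework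

variable {X A B C : Type} [Enc X] [Enc A] [Enc B] [Enc C] {Os : Set (Val → Val)}

/-- The length of the code of `a`. -/
def sz (a : A) : ℕ := (enc a).size

theorem Val.one_le_size (v : Val) : 1 ≤ v.size := by
  cases v <;> simp [Val.size]

theorem one_le_sz (a : A) : 1 ≤ sz a := Val.one_le_size _

/-- Every rule charges the sizes of its input and output. Hence time bounds are also size bounds,
which is what makes them compose. -/
theorem Runs.size_le {O : Val → Val} {p : Prog} {x y : Val} {t : ℕ} (h : Runs O p x y t) :
    x.size ≤ t ∧ y.size ≤ t := by
  cases h <;> constructor <;> omega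

theorem polynomial_eval_mono (b : Polynomial ℕ) {m n : ℕ} (h : m ≤ n) : b.eval m ≤ b.eval n := by
  rw [Polynomial.eval_eq_sum, Polynomial.eval_eq_sum]
  exact Finset.sum_le_sum fun i _ => Nat.mul_le_mul_left _ (Nat.pow_le_pow_left h i)

/-- Some program computes `f` in polynomial time, with any oracle of the set `Os`. -/
def PT (Os : Set (Val → Val)) (f : A → B) : Prop :=
  ∃ (p : Prog) (b : Polynomial ℕ), ∀ O ∈ Os, ∀ a : A,
    ∃ t ≤ b.eval (sz a), Runs O p (enc a) (enc (f a)) t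

/-- The size of the result is polynomially bounded. -/
def PolySized (f : A → B) : Prop :=
  ∃ b : Polynomial ℕ, ∀ a : A, sz (f a) ≤ b.eval (sz a)

theorem PT.polySized {f : A → B} (h : PT Os f) (hO : Os.Nonempty) : PolySized f := by
  obtain ⟨p, b, h⟩ := h
  obtain ⟨O, hO⟩ := hO
  refine ⟨b, fun a => ?_⟩
  obtain ⟨t, ht, hr⟩ := h O hO a
  exact hr.size_le.2.trans ht

theorem PT.of_op (o : Op) {f : A → B} (h : ∀ a, o.apply (enc a) = enc (f a))
    (hs : PolySized f) : PT Os f := by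
  obtain ⟨b, hb⟩ := hs
  refine ⟨.op o, .X + b, fun O _ a => ⟨_, ?_, h a ▸ Runs.op o (enc a)⟩⟩
  simpa [sz] using hb a

theorem polySized_of_le {f : A → B} (h : ∀ a, sz (f a) ≤ sz a) : PolySized f :=
  ⟨.X, fun a => by simpa using h a⟩

/-- Functions that do not alter the code. -/
theorem PT.of_enc_eq {f : A → B} (h : ∀ a, enc (f a) = enc a) : PT Os f :=
  .of_op .id (fun a => (h a).symm) (polySized_of_le fun a => by simp [sz, h])

theorem PT.id : PT Os (fun a : A => a) := .of_enc_eq fun _ => rfl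

theorem PT.const (c : B) : PT Os (fun _ : A => c) :=
  .of_op (.const (enc c)) (fun _ => rfl) ⟨.C (sz c), fun a => by simp⟩

theorem PT.comp {g : B → C} {f : A → B} (hg : PT Os g) (hf : PT Os f) :
    PT Os (fun a => g (f a)) := by
  obtain ⟨p, b, hp⟩ := hf
  obtain ⟨q, c, hq⟩ := hg
  refine ⟨.seq p q, b + c.comp b + .X + c.comp b, fun O hO a => ?_⟩
  obtain ⟨s, hs, hrs⟩ := hp O hO a
  obtain ⟨t, ht, hrt⟩ := hq O hO (f a)
  refine ⟨_, ?_, Runs.seq hrs hrt⟩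
  -- The intermediate value was produced within time `b`, so its size is at most `b` too.
  have h1 : t ≤ c.eval (b.eval (sz a)) :=
    ht.trans (polynomial_eval_mono c (hrs.size_le.2.trans hs))
  have h2 := hrt.size_le.2
  simp only [Polynomial.eval_add, Polynomial.eval_comp, Polynomial.eval_X]
  have : (enc a).size = sz a := rfl
  omega

instance : Enc ℕ := ⟨.nat⟩

instance : Enc Bool := ⟨fun b => .nat b.toNat⟩

instance : Enc (A × B) := ⟨fun x => .pair (enc x.1) (enc x.2)⟩

instance : Enc (List A) := ⟨fun l => encList (l.map enc)⟩

theorem sz_prod (a : A) (b : B) : sz (a, b) = sz a + sz b + 1 := rfl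

theorem sz_prod' (x : A × B) : sz x = sz x.1 + sz x.2 + 1 := rfl

theorem sz_nat (n : ℕ) : sz n = Nat.size n + 1 := rfl

theorem sz_nil : sz ([] : List A) = 1 := by simp [sz, enc, encList, Val.size]

theorem sz_cons (a : A) (l : List A) : sz (a :: l) = sz a + sz l + 1 := rfl

theorem sz_append (l l' : List A) : sz (l ++ l') + 1 = sz l + sz l' := by
  induction l with
  | nil => simp [sz_nil]; omega
  | cons a l ih => simp only [List.cons_append, sz_cons]; omega

theorem length_lt_sz (l : List A) : l.length < sz l := by
  induction l with
  | nil => simp [sz_nil]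
  | cons a l ih => simp only [List.length_cons, sz_cons]; omega

theorem sz_le_of_mem {a : A} {l : List A} (h : a ∈ l) : sz a ≤ sz l := by
  induction l with
  | nil => simp at h
  | cons b l ih =>
    rw [sz_cons]
    rcases List.mem_cons.1 h with rfl | h
    · omega
    · have := ih h; omega


theorem sz_list_le {l : List A} {c : ℕ} (h : ∀ a ∈ l, sz a ≤ c) :
    sz l ≤ l.length * (c + 1) + 1 := by
  induction l with
  | nil => simp [sz_nil]
  | cons a l ih =>
    have h1 := ih fun a ha => h a (by simp [ha])
    have h2 := h a (by simp)
    rw [sz_cons, List.length_cons, add_mul]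
    omega

theorem PT.pair {f : A → B} {g : A → C} (hf : PT Os f) (hg : PT Os g) :
    PT Os (fun a => (f a, g a)) := by
  obtain ⟨p, b, hp⟩ := hf
  obtain ⟨q, c, hq⟩ := hg
  refine ⟨.pair p q, b + c + .X + (b + c + 1), fun O hO a => ?_⟩
  obtain ⟨s, hs, hrs⟩ := hp O hO a
  obtain ⟨t, ht, hrt⟩ := hq O hO a
  refine ⟨_, ?_, Runs.pair hrs hrt⟩
  have h1 := hrs.size_le.2
  have h2 := hrt.size_le.2
  have : (enc a).size = sz a := rfl
  simp only [Polynomial.eval_add, Polynomial.eval_X, Polynomial.eval_one, Val.size]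
  omega

theorem PT.fst {f : A → B × C} (hf : PT Os f) : PT Os (fun a => (f a).1) :=
  PT.comp (g := Prod.fst)
    (.of_op .fst (fun _ => rfl) (polySized_of_le fun a => by rw [sz_prod' a]; omega)) hf

theorem PT.snd {f : A → B × C} (hf : PT Os f) : PT Os (fun a => (f a).2) :=
  PT.comp (g := Prod.snd)
    (.of_op .snd (fun _ => rfl) (polySized_of_le fun a => by rw [sz_prod' a]; omega)) hf

theorem PT.ite {c : A → Bool} {f g : A → B} (hc : PT Os c) (hf : PT Os f) (hg : PT Os g) :
    PT Os (fun a => if c a then f a else g a) := by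
  obtain ⟨r, d, hr⟩ := hc
  obtain ⟨p, b, hp⟩ := hf
  obtain ⟨q, e, hq⟩ := hg
  refine ⟨.ite r p q, d + b + e + .X + (b + e), fun O hO a => ?_⟩
  obtain ⟨u, hu, hru⟩ := hr O hO a
  obtain ⟨s, hs, hrs⟩ := hp O hO a
  obtain ⟨t, ht, hrt⟩ := hq O hO a
  have h1 := hrs.size_le.2
  have h2 := hrt.size_le.2
  have : (enc a).size = sz a := rfl
  simp only [Polynomial.eval_add, Polynomial.eval_X]
  cases h : c a
  · rw [h] at hru
    exact ⟨_, by simp only [Bool.false_eq_true, if_false]; omega, Runs.ite_false hru hrt⟩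
  · rw [h] at hru
    exact ⟨_, by simp only [if_true]; omega, Runs.ite_true hru (by simp [enc]) hrs⟩

theorem PT.not {c : A → Bool} (hc : PT Os c) : PT Os (fun a => !c a) := by
  have h := hc.ite (PT.const false) (PT.const true)
  refine (funext fun a => ?_ : (fun a => !c a) = _) ▸ h
  cases c a <;> rfl

theorem PT.and {c d : A → Bool} (hc : PT Os c) (hd : PT Os d) : PT Os (fun a => c a && d a) := by
  have h := hc.ite hd (PT.const false)
  refine (funext fun a => ?_ : (fun a => c a && d a) = _) ▸ h
  cases c a <;> rfl

theorem PT.or {c d : A → Bool} (hc : PT Os c) (hd : PT Os d) : PT Os (fun a => c a || d a) := by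
  have h := hc.ite (PT.const true) hd
  refine (funext fun a => ?_ : (fun a => c a || d a) = _) ▸ h
  cases c a <;> rfl

theorem PT.congr {f g : A → B} (hf : PT Os f) (h : ∀ a, g a = f a) : PT Os g :=
  (funext h : g = f) ▸ hf

/-- The instruction compares codes, so injectivity of the coding is what makes it decide equality of
elements. -/
theorem PT.eqTest (hB : Function.Injective (enc : B → Val)) [DecidableEq B] {f g : A → B}
    (hf : PT Os f) (hg : PT Os g) : PT Os (fun a => decide (f a = g a)) := by
  refine PT.comp (g := fun x : B × B => decide (x.1 = x.2)) ?_ (hf.pair hg)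
  refine .of_op .eq (fun x => ?_) (polySized_of_le fun x => ?_)
  · change (if enc x.1 = enc x.2 then Val.nat 1 else .nat 0) = Val.nat (decide (x.1 = x.2)).toNat
    by_cases h : x.1 = x.2 <;> simp [h, hB.eq_iff]
  · have h1 := one_le_sz x.1
    have h2 := one_le_sz x.2
    have h3 : sz (decide (x.1 = x.2)) ≤ 2 := by
      cases decide (x.1 = x.2) <;> simp [sz, enc, Val.size]
    rw [sz_prod' x]
    omega

theorem enc_nat_injective : Function.Injective (enc : ℕ → Val) := fun _ _ h => Val.nat.inj h

theorem size_mul_le (m n : ℕ) : Nat.size (m * n) ≤ Nat.size m + Nat.size n := by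
  rw [Nat.size_le, pow_add]
  exact Nat.mul_lt_mul'' (Nat.lt_size_self m) (Nat.lt_size_self n)

theorem size_add_le (m n : ℕ) : Nat.size (m + n) ≤ Nat.size m + Nat.size n + 1 := by
  rw [Nat.size_le, pow_succ, pow_add]
  have h1 := Nat.lt_size_self m
  have h2 := Nat.lt_size_self n
  nlinarith [Nat.one_le_two_pow (n := Nat.size m), Nat.one_le_two_pow (n := Nat.size n)]

theorem PT.arith (o : Op) (F : ℕ → ℕ → ℕ) (ho : ∀ x, o.apply x = x.arith F)
    (hF : ∀ m n, Nat.size (F m n) ≤ Nat.size m + Nat.size n + 1) {f g : A → ℕ}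
    (hf : PT Os f) (hg : PT Os g) : PT Os (fun a => F (f a) (g a)) := by
  refine PT.comp (g := fun x : ℕ × ℕ => F x.1 x.2) ?_ (hf.pair hg)
  refine .of_op o (fun x => by rw [ho]; rfl) (polySized_of_le fun x => ?_)
  have := hF x.1 x.2
  rw [sz_prod' x, sz_nat, sz_nat, sz_nat]
  omega

theorem PT.add {f g : A → ℕ} (hf : PT Os f) (hg : PT Os g) : PT Os (fun a => f a + g a) :=
  .arith .add (· + ·) (fun _ => rfl) size_add_le hf hg

theorem PT.mul {f g : A → ℕ} (hf : PT Os f) (hg : PT Os g) : PT Os (fun a => f a * g a) :=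
  .arith .mul (· * ·) (fun _ => rfl) (fun m n => (size_mul_le m n).trans (by omega)) hf hg

theorem PT.sub {f g : A → ℕ} (hf : PT Os f) (hg : PT Os g) : PT Os (fun a => f a - g a) :=
  .arith .sub (· - ·) (fun _ => rfl)
    (fun m n => (Nat.size_le_size (Nat.sub_le m n)).trans (by omega)) hf hg

theorem PT.div {f g : A → ℕ} (hf : PT Os f) (hg : PT Os g) : PT Os (fun a => f a / g a) :=
  .arith .div (· / ·) (fun _ => rfl)
    (fun m n => (Nat.size_le_size (Nat.div_le_self m n)).trans (by omega)) hf hg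

theorem PT.mod {f g : A → ℕ} (hf : PT Os f) (hg : PT Os g) : PT Os (fun a => f a % g a) :=
  (hf.sub (hg.mul (hf.div hg))).congr fun _ => Nat.mod_eq_sub _ _

theorem PT.natEq {f g : A → ℕ} (hf : PT Os f) (hg : PT Os g) :
    PT Os (fun a => decide (f a = g a)) := .eqTest enc_nat_injective hf hg

/-- Running a loop along a sequence of states. -/
theorem Runs.loop_of_seq {O : Val → Val} {p : Prog} {c : ℕ} (N : ℕ) (st : ℕ → Val)
    (h : ∀ j < N, (st j).fst ≠ .nat 0 ∧ ∃ t ≤ c, Runs O p (st j) (st (j + 1)) t)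
    (hN : (st N).fst = .nat 0) :
    ∃ t ≤ N * (2 * c + (st N).size) + 2 * (st N).size, Runs O (.loop p) (st 0) (st N) t := by
  induction N generalizing st with
  | zero => exact ⟨_, by omega, Runs.loop_done hN⟩
  | succ N ih =>
    obtain ⟨t, ht, hr⟩ := ih (fun j => st (j + 1)) (fun j hj => h (j + 1) (by omega)) hN
    obtain ⟨h0, s, hs, hr0⟩ := h 0 (by omega)
    refine ⟨_, ?_, Runs.loop_step h0 hr0 hr⟩
    have := hr0.size_le.1
    rw [add_mul]
    omega

/-- Iterating a polynomial-time step may blow up the accumulator, so its size has to be bounded on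
every prefix of the list. The loop state is the remaining list, the input and the accumulator. The
loop stops at the right moment because the code of a list is the leaf `0` exactly when the list is
empty. -/
theorem PT.foldl {S : Type} [Enc S] {l : X → List A} {s : X → S} {step : X → S → A → S}
    (hl : PT Os l) (hs : PT Os s)
    (hstep : PT Os (fun q : X × S × A => step q.1 q.2.1 q.2.2))
    (hB : ∃ b : Polynomial ℕ, ∀ x l', l' <+: l x → sz (l'.foldl (step x) (s x)) ≤ b.eval (sz x)) :
    PT Os (fun x => (l x).foldl (step x) (s x)) := by
  -- Size bounds are extracted from runs, which requires an oracle to run with. Without any oracle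
  -- the claim is vacuous.
  rcases Os.eq_empty_or_nonempty with rfl | hO
  · exact ⟨.oracle, 0, by simp⟩
  have hG : PT Os (fun q : (A × List A) × (X × S) =>
      (q.1.2, (q.2.1, step q.2.1 q.2.2 q.1.1))) :=
    PT.id.fst.snd.pair (PT.id.snd.fst.pair
      (hstep.comp (PT.id.snd.fst.pair (PT.id.snd.snd.pair PT.id.fst.fst))))
  have hinit : PT Os (fun x => (l x, (x, s x))) := hl.pair (PT.id.pair hs)
  suffices H : PT Os (fun q : X => (([] : List A), (q, (l q).foldl (step q) (s q)))) from
    (H.snd.snd : _)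
  obtain ⟨bl, hbl⟩ := hl.polySized hO
  obtain ⟨p, c, hp⟩ := hG
  obtain ⟨p0, c0, hp0⟩ := hinit
  obtain ⟨b, hB⟩ := hB
  refine ⟨.seq p0 (.loop p),
    c0 + (bl * (2 * c.comp (bl + .X + b + 3) + (1 + .X + b + 2)) + 2 * (1 + .X + b + 2)) + .X
      + (1 + .X + b + 2), fun O hO x => ?_⟩
  obtain ⟨t0, ht0, hr0⟩ := hp0 O hO x
  let st : ℕ → Val := fun j => enc ((l x).drop j, (x, ((l x).take j).foldl (step x) (s x)))
  have hst0 : st 0 = enc (l x, (x, s x)) := by simp [st]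
  have hstN : st (l x).length = enc (([] : List A), (x, (l x).foldl (step x) (s x))) := by
    simp [st]
  have hdrop : ∀ j, sz ((l x).drop j) ≤ bl.eval (sz x) := fun j => by
    have h1 := sz_append ((l x).take j) ((l x).drop j)
    have h2 := one_le_sz ((l x).take j)
    rw [List.take_append_drop] at h1
    have := hbl x
    omega
  obtain ⟨t, ht, hr⟩ := Runs.loop_of_seq (O := O) (p := p)
    (c := c.eval (bl.eval (sz x) + sz x + b.eval (sz x) + 3)) (l x).length st (fun j hj => by
      have hd : (l x).drop j = (l x)[j] :: (l x).drop (j + 1) := List.drop_eq_getElem_cons hj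
      refine ⟨?_, ?_⟩
      · simp only [st]
        rw [hd]
        intro h
        cases h
      obtain ⟨t, ht, hr⟩ := hp O hO (((l x)[j], (l x).drop (j + 1)),
        (x, ((l x).take j).foldl (step x) (s x)))
      refine ⟨t, ht.trans (polynomial_eval_mono c ?_), ?_⟩
      · have h1 := hdrop j
        rw [hd, sz_cons] at h1
        have h2 := hB x _ (List.take_prefix j (l x))
        simp only [sz_prod]
        omega
      · have e1 : st j = enc (((l x)[j], (l x).drop (j + 1)),
            (x, ((l x).take j).foldl (step x) (s x))) := by
          simp only [st, hd]; rfl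
        have e2 : st (j + 1) = enc ((l x).drop (j + 1),
            (x, step x (((l x).take j).foldl (step x) (s x)) (l x)[j])) := by
          simp only [st, List.take_succ_eq_append_getElem hj, List.foldl_append, List.foldl_cons,
            List.foldl_nil]
        rw [e1, e2]
        exact hr) (by rw [hstN]; rfl)
  rw [hstN, hst0] at hr
  refine ⟨_, ?_, Runs.seq hr0 hr⟩
  have h1 : (st (l x).length).size ≤ 1 + sz x + b.eval (sz x) + 2 := by
    rw [hstN]
    have := hB x _ (List.prefix_refl _)
    change sz _ ≤ _
    simp only [sz_prod, sz_nil]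
    omega
  have h2 : (l x).length ≤ bl.eval (sz x) := ((length_lt_sz _).le).trans (hbl x)
  have h3 : t ≤ bl.eval (sz x) * (2 * c.eval (bl.eval (sz x) + sz x + b.eval (sz x) + 3)
      + (1 + sz x + b.eval (sz x) + 2)) + 2 * (1 + sz x + b.eval (sz x) + 2) :=
    ht.trans (by gcongr)
  rw [← hstN]
  have : (enc x).size = sz x := rfl
  simp only [Polynomial.eval_add, Polynomial.eval_mul, Polynomial.eval_comp, Polynomial.eval_X,
    Polynomial.eval_one, Polynomial.eval_ofNat]
  omega

/-- A fold whose accumulator grows, at each step, by an amount that does not depend on it. -/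
theorem PT.foldl_of_growth {S : Type} [Enc S] {l : X → List A} {s : X → S} {step : X → S → A → S}
    (hl : PT Os l) (hs : PT Os s)
    (hstep : PT Os (fun q : X × S × A => step q.1 q.2.1 q.2.2))
    (hB : ∃ b : Polynomial ℕ, ∀ x s a, sz (step x s a) ≤ sz s + b.eval (sz x + sz a)) :
    PT Os (fun x => (l x).foldl (step x) (s x)) := by
  rcases Os.eq_empty_or_nonempty with rfl | hO
  · exact ⟨.oracle, 0, by simp⟩
  refine hl.foldl hs hstep ?_
  obtain ⟨b, hb⟩ := hB
  obtain ⟨bl, hbl⟩ := hl.polySized hO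
  obtain ⟨bs, hbs⟩ := hs.polySized hO
  refine ⟨bs + bl * b.comp (.X + bl), fun x l' hl' => ?_⟩
  have key : ∀ (l' : List A) (s : S), (∀ a ∈ l', sz a ≤ bl.eval (sz x)) →
      sz (l'.foldl (step x) s) ≤ sz s + l'.length * b.eval (sz x + bl.eval (sz x)) := by
    intro l'
    induction l' with
    | nil => simp
    | cons a l' ih =>
      intro s h
      have h1 := ih (step x s a) fun a ha => h a (by simp [ha])
      have h2 := hb x s a
      have h3 : b.eval (sz x + sz a) ≤ b.eval (sz x + bl.eval (sz x)) :=
        polynomial_eval_mono b (by have := h a (by simp); omega)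
      rw [List.foldl_cons, List.length_cons, add_mul]
      omega
  have h1 := key l' (s x) fun a ha => (sz_le_of_mem (hl'.subset ha)).trans (hbl x)
  have h2 : l'.length ≤ bl.eval (sz x) :=
    hl'.length_le.trans ((length_lt_sz _).le.trans (hbl x))
  have h3 := hbs x
  simp only [Polynomial.eval_add, Polynomial.eval_mul, Polynomial.eval_comp, Polynomial.eval_X]
  exact h1.trans (by gcongr)

end Framework

/-! ### Lists, finite case distinctions and tuples in polynomial time. -/

section Lists

variable {X A B : Type} [Enc X] [Enc A] [Enc B] {Os : Set (Val → Val)}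

theorem PT.of_isEmpty [IsEmpty A] {f : A → B} : PT Os f :=
  ⟨.oracle, 0, fun _ _ a => isEmptyElim a⟩

theorem PT.cons {f : X → A} {l : X → List A} (hf : PT Os f) (hl : PT Os l) :
    PT Os (fun x => f x :: l x) :=
  (PT.of_enc_eq (f := fun y : A × List A => y.1 :: y.2) fun _ => rfl).comp (hf.pair hl)

theorem PT.singleton {f : X → A} (hf : PT Os f) : PT Os (fun x => [f x]) :=
  hf.cons (.const [])

theorem PT.reverse {l : X → List A} (hl : PT Os l) : PT Os (fun x => (l x).reverse) := by
  have h := hl.foldl_of_growth (s := fun _ => ([] : List A)) (step := fun _ s a => a :: s)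
    (.const _) (PT.id.snd.snd.cons PT.id.snd.fst)
    ⟨.X + 1, fun x s a => by rw [sz_cons]; simp; omega⟩
  refine h.congr fun x => ?_
  have key : ∀ l s : List A, l.foldl (fun s a => a :: s) s = l.reverse ++ s := fun l => by
    induction l with
    | nil => simp
    | cons a l ih => simp [ih]
  simp [key]

theorem PT.append {l l' : X → List A} (hl : PT Os l) (hl' : PT Os l') :
    PT Os (fun x => l x ++ l' x) := by
  have h := hl.reverse.foldl_of_growth (s := l') (step := fun _ s a => a :: s)
    hl' (PT.id.snd.snd.cons PT.id.snd.fst)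
    ⟨.X + 1, fun x s a => by rw [sz_cons]; simp; omega⟩
  refine h.congr fun x => ?_
  have key : ∀ l s : List A, l.foldl (fun s a => a :: s) s = l.reverse ++ s := fun l => by
    induction l with
    | nil => simp
    | cons a l ih => simp [ih]
  simp [key]

theorem PT.flatMap {l : X → List A} {f : X → A → List B} (hl : PT Os l)
    (hf : PT Os (fun q : X × A => f q.1 q.2)) : PT Os (fun x => (l x).flatMap (f x)) := by
  rcases Os.eq_empty_or_nonempty with rfl | hO
  · exact ⟨.oracle, 0, by simp⟩
  obtain ⟨b, hb⟩ := hf.polySized hO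
  have h := hl.foldl_of_growth (s := fun _ => ([] : List B)) (step := fun x s a => s ++ f x a)
    (.const _) (PT.id.snd.fst.append (hf.comp (PT.id.fst.pair PT.id.snd.snd)))
    ⟨b.comp (.X + 1), fun x s a => by
      have h1 := hb (x, a)
      have h2 := sz_append s (f x a)
      rw [sz_prod] at h1
      simp only [Polynomial.eval_comp, Polynomial.eval_add, Polynomial.eval_X,
        Polynomial.eval_one] at *
      omega⟩
  refine h.congr fun x => ?_
  have key : ∀ (l : List A) (s : List B), l.foldl (fun s a => s ++ f x a) s = s ++ l.flatMap (f x) :=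
    fun l => by
      induction l with
      | nil => simp
      | cons a l ih => simp [ih]
  simp [key]

theorem PT.map {l : X → List A} {f : X → A → B} (hl : PT Os l)
    (hf : PT Os (fun q : X × A => f q.1 q.2)) : PT Os (fun x => (l x).map (f x)) :=
  (hl.flatMap (f := fun x a => [f x a]) hf.singleton).congr fun _ => List.map_eq_flatMap

/-- Mapping over a list that does not depend on the input. -/
theorem PT.map_const {J : Type} (js : List J) {f : J → X → B} (hf : ∀ j ∈ js, PT Os (f j)) :
    PT Os (fun x => js.map fun j => f j x) := by
  induction js with
  | nil => exact .const []
  | cons j js ih => exact (hf j (by simp)).cons (ih fun j hj => hf j (by simp [hj]))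


theorem sz_bool_le (b : Bool) : sz b ≤ 2 := by
  cases b <;> simp [sz, enc, Val.size]

theorem PT.mem [DecidableEq A] (hA : Function.Injective (enc : A → Val)) {y : X → A}
    {l : X → List A} (hy : PT Os y) (hl : PT Os l) : PT Os (fun x => decide (y x ∈ l x)) := by
  have h := hl.foldl_of_growth (s := fun _ => false) (step := fun x s a => s || decide (y x = a))
    (.const _) (PT.id.snd.fst.or (PT.eqTest hA (hy.comp PT.id.fst) PT.id.snd.snd))
    ⟨2, fun x s a => by
      have := sz_bool_le (s || decide (y x = a))
      simp only [Polynomial.eval_ofNat]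
      omega⟩
  refine h.congr fun x => ?_
  have key : ∀ (l : List A) (s : Bool),
      l.foldl (fun s a => s || decide (y x = a)) s = (s || decide (y x ∈ l)) := fun l => by
    induction l with
    | nil => simp
    | cons a l ih =>
      intro s
      rw [List.foldl_cons, ih]
      by_cases h : y x = a <;> simp [h]
  simp [key]

/-- The elements of a list without repetitions. -/
def dedupFold [DecidableEq A] (l : List A) : List A :=
  l.foldl (fun s a => if decide (a ∈ s) then s else a :: s) []

omit [Enc A] in
theorem dedupFold_spec [DecidableEq A] (l : List A) :
    (dedupFold l).Nodup ∧ (∀ a, a ∈ dedupFold l ↔ a ∈ l) ∧ (dedupFold l).length ≤ l.length := by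
  have key : ∀ (l s : List A), s.Nodup →
      let r := l.foldl (fun s a => if decide (a ∈ s) then s else a :: s) s
      r.Nodup ∧ (∀ a, a ∈ r ↔ a ∈ s ∨ a ∈ l) ∧ r.length ≤ s.length + l.length := fun l => by
    induction l with
    | nil => intro s hs; simp [hs]
    | cons a l ih =>
      intro s hs
      by_cases ha : a ∈ s
      · obtain ⟨h1, h2, h3⟩ := ih s hs
        simp only [List.foldl_cons, ha, decide_true, if_true]
        refine ⟨h1, fun b => ?_, h3.trans (by simp)⟩
        rw [h2, List.mem_cons]
        constructor
        · rintro (h | h) <;> simp [h]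
        · rintro (h | rfl | h) <;> simp [*]
      · obtain ⟨h1, h2, h3⟩ := ih (a :: s) (by simp [ha, hs])
        simp only [List.foldl_cons, ha, decide_false, Bool.false_eq_true, if_false]
        refine ⟨h1, fun b => ?_, h3.trans (by simp; omega)⟩
        rw [h2, List.mem_cons, List.mem_cons]
        tauto
  obtain ⟨h1, h2, h3⟩ := key l [] List.nodup_nil
  exact ⟨h1, fun a => by simpa [dedupFold] using h2 a, by simpa [dedupFold] using h3⟩

theorem PT.dedupFold [DecidableEq A] (hA : Function.Injective (enc : A → Val)) {l : X → List A}
    (hl : PT Os l) : PT Os (fun x => dedupFold (l x)) := by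
  refine hl.foldl_of_growth (s := fun _ => ([] : List A))
    (step := fun _ s a => if decide (a ∈ s) then s else a :: s) (.const _)
    (PT.ite (PT.mem hA PT.id.snd.snd PT.id.snd.fst) PT.id.snd.fst
      (PT.id.snd.snd.cons PT.id.snd.fst))
    ⟨.X + 1, fun x s a => ?_⟩
  simp only [Polynomial.eval_add, Polynomial.eval_X, Polynomial.eval_one]
  split
  · omega
  · rw [sz_cons]; omega

theorem PT.length {l : X → List A} (hl : PT Os l) : PT Os (fun x => (l x).length) := by
  have h := hl.foldl_of_growth (s := fun _ => 0) (step := fun _ s _ => s + 1)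
    (.const _) (PT.id.snd.fst.add (.const 1))
    ⟨2, fun x s a => by
      have := size_add_le s 1
      simp only [sz_nat, Polynomial.eval_ofNat, Nat.size_one] at *
      omega⟩
  refine h.congr fun x => ?_
  have key : ∀ (l : List A) (n : ℕ), l.foldl (fun s _ => s + 1) n = n + l.length := fun l => by
    induction l with
    | nil => simp
    | cons a l ih => intro n; simp [ih]; omega
  simp [key]

theorem size_le_self (n : ℕ) : Nat.size n ≤ n := Nat.size_le.2 Nat.lt_two_pow_self

/-- Building a list by appending blocks of bounded length, each of which depends on the length of
the list built so far. -/
theorem PT.foldl_append {l : X → List A} {s : X → List B} {block : X → ℕ → A → List B} {W : ℕ}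
    (hl : PT Os l) (hs : PT Os s)
    (hb : PT Os (fun q : X × ℕ × A => block q.1 q.2.1 q.2.2))
    (hW : ∀ x n a, (block x n a).length ≤ W) :
    PT Os (fun x => (l x).foldl (fun r a => r ++ block x r.length a) (s x)) := by
  rcases Os.eq_empty_or_nonempty with rfl | hO
  · exact ⟨.oracle, 0, by simp⟩
  obtain ⟨c, hc⟩ := hb.polySized hO
  obtain ⟨bl, hbl⟩ := hl.polySized hO
  obtain ⟨bs, hbs⟩ := hs.polySized hO
  refine hl.foldl hs (step := fun x r a => r ++ block x r.length a)
    (PT.id.snd.fst.append (hb.comp (PT.id.fst.pair (PT.id.snd.fst.length.pair PT.id.snd.snd))))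
    ⟨bs + bl * c.comp (.X + (bs + bl * .C W + 1) + bl + 2), fun x l' hl' => ?_⟩
  -- Blocks have at most `W` elements, so one bound `N` on the length holds throughout the fold. The
  -- counter passed to `block` then has size at most `N + 1`, and the growth per step does not
  -- depend on `r`.
  have key : ∀ (l' : List A) (r : List B) (N : ℕ), (∀ a ∈ l', sz a ≤ bl.eval (sz x)) →
      r.length + l'.length * W ≤ N →
      sz (l'.foldl (fun r a => r ++ block x r.length a) r) ≤
        sz r + l'.length * c.eval (sz x + (N + 1) + bl.eval (sz x) + 2) := by
    intro l'
    induction l' with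
    | nil => simp
    | cons a l' ih =>
      intro r N ha hN
      rw [List.length_cons, add_mul] at hN ⊢
      have h1 := ih (r ++ block x r.length a) N (fun a h => ha a (by simp [h])) (by
        have := hW x r.length a
        rw [List.length_append]
        omega)
      have h2 := sz_append r (block x r.length a)
      have h3 : sz (block x r.length a) ≤ c.eval (sz x + (N + 1) + bl.eval (sz x) + 2) :=
        (hc (x, r.length, a)).trans (polynomial_eval_mono c (by
          have h4 := ha a (by simp)
          have h5 := size_le_self r.length
          rw [sz_prod, sz_prod, sz_nat]
          omega))
      rw [List.foldl_cons]
      omega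
  have h2 : l'.length ≤ bl.eval (sz x) :=
    hl'.length_le.trans ((length_lt_sz _).le.trans (hbl x))
  have h3 : (s x).length ≤ bs.eval (sz x) := (length_lt_sz _).le.trans (hbs x)
  have h1 := key l' (s x) (bs.eval (sz x) + bl.eval (sz x) * W)
    (fun a ha => (sz_le_of_mem (hl'.subset ha)).trans (hbl x)) (by gcongr)
  simp only [Polynomial.eval_add, Polynomial.eval_mul, Polynomial.eval_comp, Polynomial.eval_X,
    Polynomial.eval_one, Polynomial.eval_ofNat, Polynomial.eval_C]
  exact h1.trans (by gcongr; exact hbs x)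

/-- Case distinction over a finite type. -/
theorem PT.finCases {K : Type} [Finite K] [DecidableEq K] {kind : X → K} {f : K → X → B}
    (hk : ∀ c, PT Os (fun x => decide (kind x = c))) (hf : ∀ c, PT Os (f c)) :
    PT Os (fun x => f (kind x) x) := by
  rcases isEmpty_or_nonempty X with hX | ⟨⟨x₀⟩⟩
  · exact .of_isEmpty
  have := Fintype.ofFinite K
  -- A cascade of conditionals over the values in `L`. Its final default is arbitrary, since it is
  -- never reached when `L` lists all of `K`.
  have key : ∀ L : List K, ∃ g : X → B, PT Os g ∧ ∀ x, kind x ∈ L → g x = f (kind x) x := by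
    intro L
    induction L with
    | nil => exact ⟨_, .const (f (kind x₀) x₀), by simp⟩
    | cons c L ih =>
      obtain ⟨g, hg, hgL⟩ := ih
      refine ⟨_, (hk c).ite (hf c) hg, fun x hx => ?_⟩
      by_cases h : kind x = c
      · simp [h]
      · simpa [h] using hgL x (by simpa [h] using hx)
  obtain ⟨g, hg, hgL⟩ := key Finset.univ.toList
  exact hg.congr fun x => (hgL x (by simp)).symm

instance {m : ℕ} : Enc (Fin m → A) := ⟨fun f => enc (List.ofFn f)⟩

theorem PT.pi {m : ℕ} {f : X → Fin m → A} (hf : ∀ i, PT Os (fun x => f x i)) : PT Os f := by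
  have h : PT Os (fun x => (List.finRange m).map fun i => f x i) := .map_const _ fun i _ => hf i
  simp only [← List.ofFn_eq_map] at h
  exact h

theorem PT.apply {m : ℕ} {f : X → Fin m → A} (hf : PT Os f) (i : Fin m) :
    PT Os (fun x => f x i) := by
  have key : ∀ (m : ℕ) (i : Fin m), PT Os (fun f : Fin m → A => f i) := by
    intro m
    induction m with
    | zero => exact fun i => i.elim0
    | succ m ih =>
      have h : PT Os (fun f : Fin (m + 1) → A => (f 0, fun i : Fin m => f i.succ)) :=
        .of_enc_eq fun f => by
          change _ = enc (List.ofFn f)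
          rw [List.ofFn_succ]
          rfl
      exact fun i => Fin.cases h.fst (fun i => (ih i).comp h.snd) i
  exact (key m i).comp hf

end Lists

/-! ### Greatest common divisors and rational numbers in polynomial time. -/

section Arithmetic

variable {X : Type} [Enc X] {Os : Set (Val → Val)}

/-- Euclid's algorithm, as a loop. -/
theorem Runs.euclid {O : Val → Val} {p : Prog} {c n M : ℕ}
    (hp : ∀ b a : ℕ, b ≠ 0 → b ≤ M → a ≤ M → ∃ t ≤ c, Runs O p (enc (b, a)) (enc (a % b, b)) t)
    (hM : ∀ a ≤ M, sz ((0 : ℕ), a) ≤ c) (a b : ℕ) (hba : b ≤ a) (haM : a ≤ M)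
    (h : a * b < 2 ^ n) :
    ∃ t ≤ n * (3 * c) + 2 * c,
      Runs O (.loop p) (enc (b, a)) (enc ((0 : ℕ), Nat.gcd b a)) t := by
  induction n generalizing a b with
  | zero =>
    have hb : b = 0 := by
      have : a * b = 0 := by simpa using h
      rcases Nat.mul_eq_zero.1 this with h | h <;> omega
    subst hb
    refine ⟨_, ?_, by rw [Nat.gcd_zero_left]; exact Runs.loop_done rfl⟩
    have := hM a haM
    unfold sz at this
    omega
  | succ n ih =>
    rcases eq_or_ne b 0 with rfl | hb
    · refine ⟨_, ?_, by rw [Nat.gcd_zero_left]; exact Runs.loop_done rfl⟩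
      have := hM a haM
      unfold sz at this
      rw [add_mul]
      omega
    · have hr := Nat.mod_lt a (Nat.pos_of_ne_zero hb)
      -- Since `b + a % b ≤ a` and `a % b < b`, each round at least halves the product of the two
      -- entries. The number of rounds is thus bounded by the bit length of the initial product.
      have hlt : b * (a % b) < 2 ^ n := by
        have h1 : b + a % b ≤ a := by
          have h2 := Nat.mod_add_div a b
          have h3 : 1 ≤ a / b := (Nat.one_le_div_iff (Nat.pos_of_ne_zero hb)).2 hba
          nlinarith
        rw [pow_succ] at h
        nlinarith
      obtain ⟨t, ht, hrt⟩ := ih b (a % b) hr.le (hba.trans haM) hlt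
      obtain ⟨s, hs, hrs⟩ := hp b a hb (hba.trans haM) haM
      rw [← Nat.gcd_rec] at hrt
      refine ⟨_, ?_, Runs.loop_step (fun h => hb (Val.nat.inj h)) hrs hrt⟩
      have h1 := hM (Nat.gcd b a) ((Nat.gcd_le_left a (Nat.pos_of_ne_zero hb)).trans
        (hba.trans haM))
      have h2 := hrs.size_le.1
      unfold sz at h1
      rw [add_mul]
      omega

theorem PT.gcd {f g : X → ℕ} (hf : PT Os f) (hg : PT Os g) :
    PT Os (fun x => Nat.gcd (f x) (g x)) := by
  -- Adding the first entry to the second keeps the gcd and provides the ordering `b ≤ a` that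
  -- `Runs.euclid` needs at the start.
  suffices h : PT Os (fun q : ℕ × ℕ => ((0 : ℕ), Nat.gcd q.1 (q.2 + q.1))) from
    (h.comp (hf.pair hg)).snd.congr fun x => by simp
  have hinit : PT Os (fun q : ℕ × ℕ => (q.1, q.2 + q.1)) :=
    PT.id.fst.pair (PT.id.snd.add PT.id.fst)
  have hstep : PT Os (fun q : ℕ × ℕ => (q.2 % q.1, q.1)) :=
    (PT.id.snd.mod PT.id.fst).pair PT.id.fst
  obtain ⟨p, b, hp⟩ := hstep
  obtain ⟨p0, b0, hp0⟩ := hinit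
  refine ⟨.seq p0 (.loop p), b0 + (2 * .X * (3 * (b.comp (2 * .X + 3) + (2 * .X + 3)))
    + 2 * (b.comp (2 * .X + 3) + (2 * .X + 3))) + .X + (2 * .X + 3), fun O hO q => ?_⟩
  obtain ⟨t0, ht0, hr0⟩ := hp0 O hO q
  have hq : Nat.size q.1 + Nat.size q.2 + 3 = sz q := by
    rw [sz_prod' q, sz_nat, sz_nat]; ring
  have hsum := size_add_le q.2 q.1
  have hle : ∀ a ≤ q.2 + q.1, Nat.size a + 2 ≤ sz q := fun a ha => by
    have := Nat.size_le_size ha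
    omega
  obtain ⟨t, ht, hr⟩ := Runs.euclid (O := O) (p := p) (M := q.2 + q.1)
    (c := b.eval (2 * sz q + 3) + (2 * sz q + 3)) (n := 2 * sz q)
    (fun u v _ hu hv => by
      obtain ⟨t, ht, hr⟩ := hp O hO (u, v)
      refine ⟨t, ht.trans ((polynomial_eval_mono b ?_).trans (Nat.le_add_right _ _)), hr⟩
      have h1 := hle u hu
      have h2 := hle v hv
      rw [sz_prod, sz_nat, sz_nat]
      omega)
    (fun a ha => by
      have h1 := hle a ha
      rw [sz_prod, sz_nat, sz_nat, Nat.size_zero]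
      omega)
    (q.2 + q.1) q.1 (by omega) le_rfl (by
      have h1 := hle (q.2 + q.1) le_rfl
      have h2 := hle q.1 (by omega)
      refine (Nat.lt_size_self _).trans_le (Nat.pow_le_pow_right (by norm_num) ?_)
      have := size_mul_le (q.2 + q.1) q.1
      omega)
  refine ⟨_, ?_, Runs.seq hr0 hr⟩
  have h1 : sz ((0 : ℕ), Nat.gcd q.1 (q.2 + q.1)) ≤ 2 * sz q + 3 := by
    have h2 := hle (Nat.gcd q.1 (q.2 + q.1)) (by
      rcases Nat.eq_zero_or_pos q.1 with h | h
      · simp [h]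
      · exact (Nat.gcd_le_left _ h).trans (by omega))
    rw [sz_prod, sz_nat, sz_nat, Nat.size_zero]
    omega
  unfold sz at *
  simp only [Polynomial.eval_add, Polynomial.eval_mul, Polynomial.eval_comp, Polynomial.eval_X,
    Polynomial.eval_ofNat]
  omega

instance : Enc ℚ := ⟨encRat⟩


/-- Numerator of a nonnegative rational number. -/
theorem PT.num {q : X → ℚ} (hq : PT Os q) : PT Os (fun x => (q x).num.toNat) := by
  have h : PT Os (fun q : ℚ => ((q.num.toNat, (-q.num).toNat), q.den)) := .of_enc_eq fun _ => rfl
  exact (h.comp hq).fst.fst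

theorem PT.den {q : X → ℚ} (hq : PT Os q) : PT Os (fun x => (q x).den) := by
  have h : PT Os (fun q : ℚ => ((q.num.toNat, (-q.num).toNat), q.den)) := .of_enc_eq fun _ => rfl
  exact (h.comp hq).snd

/-- Rationals are coded in lowest terms, so the gcd has to be cancelled. Denominator `0` is a
separate case: the quotient is then `0`, coded as `0 / 1`. -/
theorem PT.ratDiv {f g : X → ℕ} (hf : PT Os f) (hg : PT Os g) :
    PT Os (fun x => (f x : ℚ) / (g x : ℚ)) := by
  suffices h : PT Os (fun q : ℕ × ℕ => (q.1 : ℚ) / (q.2 : ℚ)) from h.comp (hf.pair hg)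
  have h1 : PT Os (fun q : ℕ × ℕ => if decide (q.2 = 0) then (((0 : ℕ), (0 : ℕ)), (1 : ℕ)) else
      ((q.1 / Nat.gcd q.1 q.2, 0), q.2 / Nat.gcd q.1 q.2)) :=
    (PT.id.snd.natEq (.const 0)).ite (.const _)
      (((PT.id.fst.div (PT.id.fst.gcd PT.id.snd)).pair (.const 0)).pair
        (PT.id.snd.div (PT.id.fst.gcd PT.id.snd)))
  have key : ∀ q : ℕ × ℕ, enc ((q.1 : ℚ) / (q.2 : ℚ)) =
      enc (if decide (q.2 = 0) then (((0 : ℕ), (0 : ℕ)), (1 : ℕ)) else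
        ((q.1 / Nat.gcd q.1 q.2, 0), q.2 / Nat.gcd q.1 q.2)) := by
    rintro ⟨m, n⟩
    by_cases hn : n = 0
    · subst hn
      simp [enc, encRat, encInt]
    · have hg : 0 < Nat.gcd m n := Nat.gcd_pos_of_pos_right _ (Nat.pos_of_ne_zero hn)
      have hn' : 0 < n / Nat.gcd m n :=
        Nat.div_pos (Nat.gcd_le_right _ (Nat.pos_of_ne_zero hn)) hg
      have hq : (m : ℚ) / (n : ℚ) =
          (((m / Nat.gcd m n : ℕ) : ℤ) : ℚ) / (((n / Nat.gcd m n : ℕ) : ℤ) : ℚ) := by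
        have hm : (m : ℚ) = (m / Nat.gcd m n : ℕ) * (Nat.gcd m n : ℕ) := by
          exact_mod_cast (Nat.div_mul_cancel (Nat.gcd_dvd_left m n)).symm
        have hn2 : (n : ℚ) = (n / Nat.gcd m n : ℕ) * (Nat.gcd m n : ℕ) := by
          exact_mod_cast (Nat.div_mul_cancel (Nat.gcd_dvd_right m n)).symm
        have hg' : ((Nat.gcd m n : ℕ) : ℚ) ≠ 0 := by positivity
        conv_lhs => rw [hm, hn2]
        rw [mul_div_mul_right _ _ hg']
        simp only [Int.cast_natCast]
      have hcop : Nat.Coprime (m / Nat.gcd m n) (n / Nat.gcd m n) :=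
        Nat.coprime_div_gcd_div_gcd hg
      have e1 : ((m : ℚ) / n).num = ((m / Nat.gcd m n : ℕ) : ℤ) := by
        rw [hq]; exact Rat.num_div_eq_of_coprime (by exact_mod_cast hn') hcop
      have e2 : ((m : ℚ) / n).den = n / Nat.gcd m n := by
        have : (((m : ℚ) / n).den : ℤ) = ((n / Nat.gcd m n : ℕ) : ℤ) := by
          rw [hq]; exact Rat.den_div_eq_of_coprime (by exact_mod_cast hn') hcop
        exact_mod_cast this
      clear hq hcop hn'
      generalize m / Nat.gcd m n = u at *
      simp [enc, encRat, encInt, e1, e2, hn]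
  have h2 : PT Os (fun q : ℕ × ℕ => (q.1 : ℚ) / (q.2 : ℚ)) := by
    obtain ⟨p, b, hp⟩ := h1
    refine ⟨p, b, fun O hO q => ?_⟩
    rw [key q]
    exact hp O hO q
  exact h2

end Arithmetic

/-! ### Boolean functions of equal Euler characteristic -/

section Euler

variable {V : Type} [Fintype V] [DecidableEq V]

/-- The function `φ` with its value at `ν` negated. -/
def toggle (φ : BoolFun V) (ν : Finset V) : BoolFun V := Function.update φ ν (!φ ν)

/-- The change of the Euler characteristic when the value at `ν` is negated. -/
def eulChange (φ : BoolFun V) (ν : Finset V) : ℤ := (bif φ ν then -1 else 1) * (-1) ^ ν.card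

omit [Fintype V] in
theorem toggle_self (φ : BoolFun V) (ν : Finset V) : toggle φ ν ν = !φ ν := by simp [toggle]

omit [Fintype V] in
theorem toggle_of_ne (φ : BoolFun V) {ν μ : Finset V} (h : μ ≠ ν) : toggle φ ν μ = φ μ := by
  simp [toggle, h]

omit [Fintype V] in
theorem toggle_comm (φ : BoolFun V) (ν μ : Finset V) :
    toggle (toggle φ ν) μ = toggle (toggle φ μ) ν := by
  rcases eq_or_ne ν μ with rfl | h
  · rfl
  · funext ρ
    by_cases h1 : ρ = ν <;> by_cases h2 : ρ = μ <;> simp_all [toggle, Function.update_apply]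

omit [Fintype V] in
theorem toggle_toggle (φ : BoolFun V) (ν : Finset V) : toggle (toggle φ ν) ν = φ := by
  funext ρ
  by_cases h1 : ρ = ν <;> simp_all [toggle, Function.update_apply]

omit [Fintype V] [DecidableEq V] in
theorem eulChange_eq_or (φ : BoolFun V) (ν : Finset V) :
    eulChange φ ν = 1 ∨ eulChange φ ν = -1 := by
  unfold eulChange
  rcases neg_one_pow_eq_or ℤ ν.card with h | h <;> cases φ ν <;> simp [h]

theorem eul_eq_sum (φ : BoolFun V) : eul φ = ∑ ν : Finset V, bif φ ν then (-1) ^ ν.card else 0 := by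
  rw [eul, Finset.sum_filter]
  exact Finset.sum_congr rfl fun ν _ => by cases φ ν <;> simp

theorem eul_sub_eul (φ φ' : BoolFun V) :
    eul φ' - eul φ = ∑ ν : Finset V with φ ν ≠ φ' ν, eulChange φ ν := by
  rw [eul_eq_sum, eul_eq_sum, ← Finset.sum_sub_distrib, Finset.sum_filter]
  refine Finset.sum_congr rfl fun ν _ => ?_
  unfold eulChange
  cases φ ν <;> cases φ' ν <;> simp

omit [Fintype V] in
theorem neg_one_pow_card_of_symmDiff {ν μ : Finset V} (h : (symmDiff ν μ).card = 1) :
    (-1 : ℤ) ^ μ.card = -(-1) ^ ν.card := by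
  obtain ⟨i, hi⟩ := Finset.card_eq_one.1 h
  have hμ : μ = symmDiff ν {i} := by rw [← hi, symmDiff_symmDiff_cancel_left]
  by_cases hn : i ∈ ν
  · have h1 : insert i μ = ν := by
      subst hμ; ext j; by_cases hj : j = i <;> simp_all [Finset.mem_symmDiff]
    have h2 : i ∉ μ := by subst hμ; simp [Finset.mem_symmDiff, hn]
    rw [← h1, Finset.card_insert_of_notMem h2, pow_succ]
    ring
  · have h1 : insert i ν = μ := by
      subst hμ; ext j; by_cases hj : j = i <;> simp_all [Finset.mem_symmDiff]
    rw [← h1, Finset.card_insert_of_notMem hn, pow_succ]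
    ring

omit [Fintype V] in
/-- Negating two values without changing the Euler characteristic, by successive negations of
equal values at adjacent valuations. -/
theorem toggle_pair_induction {P : BoolFun V → Prop}
    (hP : ∀ φ ν μ, (symmDiff ν μ).card = 1 → φ ν = φ μ → P φ → P (toggle (toggle φ ν) μ))
    (n : ℕ) (ν μ : Finset V) (hn : (symmDiff ν μ).card = n + 1) (φ : BoolFun V)
    (h : eulChange φ ν + eulChange φ μ = 0) (hφ : P φ) : P (toggle (toggle φ ν) μ) := by
  induction n generalizing ν φ with
  | zero =>
    refine hP φ ν μ hn ?_ hφ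
    unfold eulChange at h
    rw [neg_one_pow_card_of_symmDiff hn] at h
    rcases neg_one_pow_eq_or ℤ ν.card with h' | h' <;> rw [h'] at h <;> revert h <;>
      cases φ ν <;> cases φ μ <;> simp
  | succ n ih =>
    obtain ⟨i, hi⟩ := Finset.card_pos.1 (by omega : 0 < (symmDiff ν μ).card)
    -- The neighbour of `ν` that is one step closer to `μ`.
    set w := symmDiff ν {i} with hw
    have h1 : (symmDiff ν w).card = 1 := by rw [hw, symmDiff_symmDiff_cancel_left]; simp
    have h2 : symmDiff w μ = (symmDiff ν μ).erase i := by
      ext j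
      by_cases hj : j = i
      · subst hj
        simp only [Finset.mem_symmDiff] at hi
        simp only [hw, Finset.mem_symmDiff, Finset.mem_singleton, Finset.mem_erase]
        tauto
      · simp [hw, Finset.mem_symmDiff, hj]
    have h3 : (symmDiff w μ).card = n + 1 := by
      rw [h2, Finset.card_erase_of_mem hi, hn]; rfl
    have hνw : w ≠ ν := by rintro e; rw [e] at h1; simp at h1
    have hμw : μ ≠ w := by rintro e; rw [e] at h3; simp at h3
    have hμν : μ ≠ ν := by rintro e; rw [e] at hn; simp at hn
    have hsgn := neg_one_pow_card_of_symmDiff h1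
    -- If the values at `ν` and `w` agree, negating both gives `w` the contribution that `ν` had.
    -- The recursive call on `w, μ` then restores `w`.
    by_cases hφw : φ ν = φ w
    · have h4 := ih w h3 (toggle (toggle φ ν) w) (by
        rw [← h]
        unfold eulChange
        rw [toggle_self, toggle_of_ne _ hνw, toggle_of_ne _ hμw, toggle_of_ne _ hμν, hsgn, ← hφw]
        cases φ ν <;> simp) (hP φ ν w h1 hφw hφ)
      rwa [toggle_toggle] at h4
    -- Otherwise `w` already contributes as `ν` does. Negating `w` and `μ` first makes the values at
    -- `ν` and `w` equal, and negating these two restores `w`.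
    · have h4 := ih w h3 φ (by
        rw [← h]
        unfold eulChange
        rw [hsgn]
        revert hφw
        cases φ ν <;> cases φ w <;> simp) hφ
      have h5 := hP _ ν w h1 (by
        rw [toggle_of_ne _ hμν.symm, toggle_of_ne _ hνw.symm, toggle_of_ne _ hμw.symm, toggle_self]
        revert hφw
        cases φ ν <;> cases φ w <;> simp) h4
      rwa [toggle_comm _ μ ν, toggle_comm _ μ w, toggle_comm _ w ν, toggle_toggle] at h5

/-- Induction on the number of valuations where the functions differ. The changes at these
valuations are `1` or `-1` and sum to zero, so any one of them is cancelled by another. Negating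
both removes two differences and keeps the sum zero. -/
theorem eul_toggle_induction {P : BoolFun V → Prop}
    (hP : ∀ φ ν μ, (symmDiff ν μ).card = 1 → φ ν = φ μ → P φ → P (toggle (toggle φ ν) μ))
    (φ φ' : BoolFun V) (h : eul φ = eul φ') (hφ : P φ) : P φ' := by
  induction hn : (Finset.univ.filter fun ν => φ ν ≠ φ' ν).card using Nat.strong_induction_on
    generalizing φ with
  | _ n ih =>
  set Δ := Finset.univ.filter fun ν => φ ν ≠ φ' ν with hΔ
  rcases Δ.eq_empty_or_nonempty with h0 | ⟨ν, hν⟩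
  · have : φ = φ' := by
      funext ν
      by_contra hne
      have : ν ∈ Δ := by simp [hΔ, hne]
      simp [h0] at this
    exact this ▸ hφ
  have hsum : ∑ μ ∈ Δ, eulChange φ μ = 0 := by rw [← eul_sub_eul, h, sub_self]
  obtain ⟨μ, hμ, hch⟩ : ∃ μ ∈ Δ, eulChange φ ν + eulChange φ μ = 0 := by
    by_contra! hne
    have hall : ∀ μ ∈ Δ, eulChange φ μ = eulChange φ ν := fun μ hμ => by
      have := hne μ hμ
      rcases eulChange_eq_or φ ν with h1 | h1 <;> rcases eulChange_eq_or φ μ with h2 | h2 <;>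
        simp_all
    rw [Finset.sum_congr rfl hall, Finset.sum_const] at hsum
    have hpos : 0 < Δ.card := Finset.card_pos.2 ⟨ν, hν⟩
    rcases eulChange_eq_or φ ν with h1 | h1 <;> simp [h1] at hsum <;> simp [hsum] at hν
  have hne : ν ≠ μ := by
    rintro rfl
    rcases eulChange_eq_or φ ν with h1 | h1 <;> simp [h1] at hch
  have hcard : (symmDiff ν μ).card ≠ 0 := by simp [hne]
  have hP' := toggle_pair_induction hP ((symmDiff ν μ).card - 1) ν μ (by omega) φ hch hφ
  have hval : ∀ ρ, toggle (toggle φ ν) μ ρ ≠ φ' ρ ↔ ρ ∈ (Δ.erase ν).erase μ := by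
    intro ρ
    simp only [hΔ, Finset.mem_filter, Finset.mem_univ, true_and] at hν hμ
    rcases eq_or_ne ρ μ with rfl | h1
    · rw [toggle_self, toggle_of_ne _ hne.symm]
      revert hμ
      cases φ ρ <;> cases φ' ρ <;> simp
    · rcases eq_or_ne ρ ν with rfl | h2
      · rw [toggle_of_ne _ h1, toggle_self]
        revert hν
        cases φ ρ <;> cases φ' ρ <;> simp
      · rw [toggle_of_ne _ h1, toggle_of_ne _ h2]
        simp [hΔ, h1, h2]
  have hset : (Finset.univ.filter fun ρ => toggle (toggle φ ν) μ ρ ≠ φ' ρ) =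
      (Δ.erase ν).erase μ := by
    ext ρ; rw [Finset.mem_filter, hval]; simp
  refine ih ((Δ.erase ν).erase μ).card ?_ (toggle (toggle φ ν) μ) ?_ hP' (by rw [hset])
  · rw [← hn]
    exact (Finset.card_le_card (Finset.erase_subset _ _)).trans_lt (Finset.card_erase_lt_of_mem hν)
  · have h1 := eul_sub_eul (toggle (toggle φ ν) μ) φ'
    have h2 : ∑ ρ ∈ (Δ.erase ν).erase μ, eulChange (toggle (toggle φ ν) μ) ρ = 0 := by
      have h3 : ∀ ρ ∈ (Δ.erase ν).erase μ, eulChange (toggle (toggle φ ν) μ) ρ = eulChange φ ρ := by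
        intro ρ hρ
        simp only [Finset.mem_erase] at hρ
        unfold eulChange
        rw [toggle_of_ne _ hρ.1, toggle_of_ne _ hρ.2.1]
      rw [Finset.sum_congr rfl h3]
      have h4 := Finset.sum_erase_add (Δ.erase ν) (eulChange φ)
        (Finset.mem_erase.2 ⟨hne.symm, hμ⟩)
      have h5 := Finset.sum_erase_add Δ (eulChange φ) hν
      linarith
    rw [hset, h2] at h1
    omega

omit [Fintype V] in
theorem erase_eq_iff {i : V} {ν μ : Finset V} (hi : i ∉ ν) :
    μ.erase i = ν ↔ μ = ν ∨ μ = insert i ν := by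
  constructor
  · rintro rfl
    by_cases h : i ∈ μ
    · exact Or.inr (Finset.insert_erase h).symm
    · exact Or.inl (Finset.erase_eq_of_notMem h).symm
  · rintro (rfl | rfl)
    · exact Finset.erase_eq_of_notMem hi
    · exact Finset.erase_insert hi

/-- A class of Boolean functions which is closed under complement, and under the addition of two
adjacent valuations, is closed under equality of Euler characteristics. -/
theorem eul_induction {P : BoolFun V → Prop} (hcompl : ∀ φ, P φ → P fun ν => !φ ν)
    (hadd : ∀ φ ν i, i ∉ ν → φ ν = false → φ (insert i ν) = false → P φ →
      P fun μ => φ μ || decide (μ.erase i = ν))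
    (φ φ' : BoolFun V) (h : eul φ = eul φ') (hφ : P φ) : P φ' := by
  have key : ∀ φ ν i, i ∉ ν → φ ν = φ (insert i ν) → P φ →
      P (toggle (toggle φ ν) (insert i ν)) := by
    intro φ ν i hi he hφ
    have hne : ν ≠ insert i ν := fun e => hi (e ▸ Finset.mem_insert_self i ν)
    cases hv : φ ν
    · have h1 := hadd φ ν i hi hv (he ▸ hv) hφ
      convert h1 using 1
      funext μ
      rcases eq_or_ne μ (insert i ν) with rfl | h1
      · rw [toggle_self, toggle_of_ne _ hne.symm, ← he, hv]
        simp [erase_eq_iff hi]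
      · rcases eq_or_ne μ ν with rfl | h2
        · rw [toggle_of_ne _ h1, toggle_self, hv]; simp [erase_eq_iff hi]
        · rw [toggle_of_ne _ h1, toggle_of_ne _ h2]; simp [erase_eq_iff hi, h1, h2]
    -- A true pair is deleted by adding it to the complement and complementing back.
    · have h1 := hcompl _ (hadd _ ν i hi (by simp [hv]) (by simp [← he, hv]) (hcompl φ hφ))
      convert h1 using 1
      funext μ
      rcases eq_or_ne μ (insert i ν) with rfl | h1
      · rw [toggle_self, toggle_of_ne _ hne.symm, ← he, hv]
        simp [erase_eq_iff hi]
      · rcases eq_or_ne μ ν with rfl | h2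
        · rw [toggle_of_ne _ h1, toggle_self, hv]; simp [erase_eq_iff hi]
        · rw [toggle_of_ne _ h1, toggle_of_ne _ h2]; simp [erase_eq_iff hi, h1, h2]
  refine eul_toggle_induction (fun φ ν μ hνμ he hφ => ?_) φ φ' h hφ
  obtain ⟨i, hi⟩ := Finset.card_eq_one.1 hνμ
  have hμ : μ = symmDiff ν {i} := by rw [← hi, symmDiff_symmDiff_cancel_left]
  by_cases hn : i ∈ ν
  · have h1 : ν = insert i μ := by
      subst hμ; ext j; by_cases hj : j = i <;> simp_all [Finset.mem_symmDiff]
    have h2 : i ∉ μ := by subst hμ; simp [Finset.mem_symmDiff, hn]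
    rw [toggle_comm, h1]
    exact key φ μ i h2 (by rw [← h1, he]) hφ
  · have h1 : μ = insert i ν := by
      subst hμ; ext j; by_cases hj : j = i <;> simp_all [Finset.mem_symmDiff]
    rw [h1]
    exact key φ ν i hn (by rw [← h1, he]) hφ

end Euler

/-! ### An automaton that reads the facts of a database -/

section Automaton

variable {k : ℕ}

/-- The constants of a fact. -/
def Fact.consts : Fact k → List ℕ
  | .R a => [a]
  | .S _ a b => [a, b]
  | .T a => [a]

/-- The index of the predicate, for binary facts. -/
def Fact.kind : Fact k → Option (Fin k)
  | .S j _ _ => some j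
  | _ => none

/-- The `t`-th predicate counted from the first one. -/
def upIndex (i : Fin (k + 1)) (t : Fin i) : Fin k := ⟨t, by omega⟩

/-- The `t`-th predicate counted from the last one. -/
def downIndex (i : Fin (k + 1)) (t : Fin (k - i)) : Fin k := ⟨k - 1 - t, by omega⟩

/-- The facts over the constants `A`: first those of `R` and of the `S j` with `j < i`, grouped by
their first component; then those of `T` and of the other `S j`, grouped by their second
component. -/
def factOrder (i : Fin (k + 1)) (A : List ℕ) : List (Fact k) :=
  (A.flatMap fun a => .R a :: A.flatMap fun b => List.ofFn fun t => .S (upIndex i t) a b) ++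
  (A.flatMap fun b => .T b :: A.flatMap fun a => List.ofFn fun t => .S (downIndex i t) a b)

/-- The query variable that is tested on reading a fact of `S j`. -/
def testIndex (i : Fin (k + 1)) (j : Fin k) : Fin (k + 1) :=
  if j.val < i.val then j.castSucc else j.succ

/-- The fact that forms, together with `S j a b`, a match of the query `testIndex i j`. -/
def partner (i : Fin (k + 1)) (j : Fin k) (a b : ℕ) : Fact k :=
  if j.val < i.val then firstAtom j.castSucc a b else secondAtom j.succ a b

/-- Whether the partner of the facts of `S j` is a unary fact. -/
def isInitial (i : Fin (k + 1)) (j : Fin k) : Bool :=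
  if j.val < i.val then decide (j.val = 0) else decide (j.val + 1 = k)

/-- A state: the queries satisfied so far, the value of the last unary fact, and the value of the
last binary fact. -/
abbrev State (k : ℕ) := Finset (Fin (k + 1)) × Bool × Bool

/-- The transition on reading a fact of the given kind and truth value. -/
def State.step (i : Fin (k + 1)) (c : Option (Fin k)) (s : State k) (v : Bool) : State k :=
  match c with
  | none => (s.1, v, s.2.2)
  | some j => (if (bif isInitial i j then s.2.1 else s.2.2) && v then insert (testIndex i j) s.1
      else s.1, s.2.1, v)

/-- The state reached after reading the facts of `L` with their values in the world `W`. -/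
def State.run (i : Fin (k + 1)) (W : Database k) (L : List (Fact k)) (s : State k) : State k :=
  L.foldl (fun s t => s.step i t.kind (decide (t ∈ W))) s

theorem State.run_append (i : Fin (k + 1)) (W : Database k) (L L' : List (Fact k)) (s : State k) :
    State.run i W (L ++ L') s = State.run i W L' (State.run i W L s) := List.foldl_append

theorem State.run_cons (i : Fin (k + 1)) (W : Database k) (t : Fact k) (L : List (Fact k))
    (s : State k) :
    State.run i W (t :: L) s = State.run i W L (s.step i t.kind (decide (t ∈ W))) := rfl

/-- For one pair `(a, b)`, the partner of each fact is the one read just before it, except that the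
first is paired with the unary fact `u`. The two remembered bits therefore suffice. The bit left
over from an earlier pair is harmless, because the first test consults the unary bit instead. -/
theorem State.run_chain (i : Fin (k + 1)) (W : Database k) (a b : ℕ) (u : Fact k) (n : ℕ)
    (f : Fin n → Fin k) (hf : ∀ t, isInitial i (f t) = decide (t.val = 0))
    (hp : ∀ t : Fin n, partner i (f t) a b =
      if t.val = 0 then u else .S (f ⟨t.val - 1, by omega⟩) a b)
    (s : State k) (hs : s.2.1 = decide (u ∈ W)) :
    (State.run i W (List.ofFn fun t => .S (f t) a b) s).2.1 = decide (u ∈ W) ∧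
    (∀ h : 0 < n, (State.run i W (List.ofFn fun t => .S (f t) a b) s).2.2 =
      decide (Fact.S (f ⟨n - 1, by omega⟩) a b ∈ W)) ∧
    ∀ x, x ∈ (State.run i W (List.ofFn fun t => .S (f t) a b) s).1 ↔ x ∈ s.1 ∨
      ∃ t, x = testIndex i (f t) ∧ .S (f t) a b ∈ W ∧ partner i (f t) a b ∈ W := by
  induction n with
  | zero => simp [State.run, hs]
  | succ n ih =>
    obtain ⟨h1, h2, h3⟩ := ih (fun t => f t.castSucc) (fun t => hf t.castSucc)
      (fun t => by rw [hp]; rfl)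
    rw [List.ofFn_succ', List.concat_eq_append, State.run_append]
    generalize State.run i W (List.ofFn fun t : Fin n => .S (f t.castSucc) a b) s = s' at *
    refine ⟨h1, fun _ => rfl, fun x => ?_⟩
    have hlast : (bif isInitial i (f (Fin.last n)) then s'.2.1 else s'.2.2) =
        decide (partner i (f (Fin.last n)) a b ∈ W) := by
      rw [hf, hp]
      rcases Nat.eq_zero_or_pos n with rfl | hn
      · simp [h1]
      · have : ¬ n = 0 := by omega
        simp only [Fin.val_last, this, decide_false, cond_false, if_false]
        exact h2 hn
    simp only [State.run, List.foldl_cons, List.foldl_nil, State.step, Fact.kind, hlast]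
    rw [Fin.exists_fin_succ', ← or_assoc, ← h3]
    by_cases hc : partner i (f (Fin.last n)) a b ∈ W <;>
      by_cases hc' : Fact.S (f (Fin.last n)) a b ∈ W <;> simp [hc, hc', or_comm]

/-- All pairs of a group share `u`, whose bit survives every chain. The function `g` covers both
groupings, by first and by second component. -/
theorem State.run_chains (i : Fin (k + 1)) (W : Database k) {n : ℕ} (f : Fin n → Fin k)
    (u : Fact k) (g : ℕ → ℕ × ℕ) (B : List ℕ)
    (hf : ∀ t, isInitial i (f t) = decide (t.val = 0))
    (hp : ∀ b ∈ B, ∀ t : Fin n, partner i (f t) (g b).1 (g b).2 =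
      if t.val = 0 then u else .S (f ⟨t.val - 1, by omega⟩) (g b).1 (g b).2)
    (s : State k) (hs : s.2.1 = decide (u ∈ W)) (x : Fin (k + 1)) :
    x ∈ (State.run i W (B.flatMap fun b => List.ofFn fun t => .S (f t) (g b).1 (g b).2) s).1 ↔
      x ∈ s.1 ∨ ∃ b ∈ B, ∃ t, x = testIndex i (f t) ∧ .S (f t) (g b).1 (g b).2 ∈ W ∧
        partner i (f t) (g b).1 (g b).2 ∈ W := by
  induction B generalizing s with
  | nil => simp [State.run]
  | cons b B ih =>
    rw [List.flatMap_cons, State.run_append]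
    obtain ⟨h1, -, h3⟩ := State.run_chain i W (g b).1 (g b).2 u n f hf (hp b (by simp)) s hs
    rw [ih (fun b hb => hp b (by simp [hb])) _ h1, h3, or_assoc]
    simp

/-- Each group starts by overwriting the unary bit, so nothing needs to be known about the bits of
`s`. This allows the two halves of `factOrder` to be run one after the other. -/
theorem State.run_groups (i : Fin (k + 1)) (W : Database k) {n : ℕ} (f : Fin n → Fin k)
    (u : ℕ → Fact k) (hu : ∀ a, (u a).kind = none) (g : ℕ → ℕ → ℕ × ℕ) (A B : List ℕ)
    (hf : ∀ t, isInitial i (f t) = decide (t.val = 0))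
    (hp : ∀ a b, ∀ t : Fin n, partner i (f t) (g a b).1 (g a b).2 =
      if t.val = 0 then u a else .S (f ⟨t.val - 1, by omega⟩) (g a b).1 (g a b).2)
    (s : State k) (x : Fin (k + 1)) :
    x ∈ (State.run i W (A.flatMap fun a => u a ::
        B.flatMap fun b => List.ofFn fun t => .S (f t) (g a b).1 (g a b).2) s).1 ↔
      x ∈ s.1 ∨ ∃ a ∈ A, ∃ b ∈ B, ∃ t, x = testIndex i (f t) ∧ .S (f t) (g a b).1 (g a b).2 ∈ W ∧
        partner i (f t) (g a b).1 (g a b).2 ∈ W := by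
  induction A generalizing s with
  | nil => simp [State.run]
  | cons a A ih =>
    rw [List.flatMap_cons, State.run_append, ih, State.run_cons,
      State.run_chains i W f (u a) (g a) B hf (fun b _ => hp a b) _ (by simp [State.step, hu]),
      or_assoc]
    simp [State.step, hu]

theorem firstAtom_zero (x y : ℕ) : firstAtom (0 : Fin (k + 1)) x y = .R x := rfl

theorem firstAtom_succ (j : Fin k) (x y : ℕ) : firstAtom j.succ x y = .S j x y := rfl

theorem secondAtom_last (x y : ℕ) : secondAtom (Fin.last k) x y = .T y := by
  simp [secondAtom]

theorem secondAtom_castSucc (j : Fin k) (x y : ℕ) : secondAtom j.castSucc x y = .S j x y := by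
  simp [secondAtom]

theorem firstAtom_of_pos (i : Fin (k + 1)) (h : 0 < i.val) (x y : ℕ) :
    firstAtom i x y = .S ⟨i.val - 1, by omega⟩ x y := by
  obtain ⟨j, rfl⟩ := Fin.exists_succ_eq.2 (Fin.pos_iff_ne_zero.1 h)
  rfl

theorem secondAtom_of_lt (i : Fin (k + 1)) (h : i.val < k) (x y : ℕ) :
    secondAtom i x y = .S ⟨i.val, h⟩ x y :=
  secondAtom_castSucc ⟨i.val, h⟩ x y

/-- Queries below `i` have both atoms in the first half of the order and queries above `i` have both
in the second half. Only `h_{k,i}` joins the halves, and it is never tested. -/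
theorem State.mem_run_factOrder (i : Fin (k + 1)) (W : Database k) (A : List ℕ)
    (hA : ∀ t ∈ W, ∀ a ∈ t.consts, a ∈ A) (x : Fin (k + 1)) :
    x ∈ (State.run i W (factOrder i A) (∅, false, false)).1 ↔ x ≠ i ∧ hk x W := by
  rw [factOrder, State.run_append,
    State.run_groups i W (downIndex i) (fun b => .T b) (fun _ => rfl) (fun b a => (a, b)) A A,
    State.run_groups i W (upIndex i) (fun a => .R a) (fun _ => rfl) (fun a b => (a, b)) A A]
  · simp only [Finset.notMem_empty, false_or]
    constructor
    · rintro (⟨a, -, b, -, t, rfl, h1, h2⟩ | ⟨b, -, a, -, t, rfl, h1, h2⟩)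
      · have ht : (upIndex i t).val < i.val := t.isLt
        simp only [partner, testIndex, ht, if_true] at h2 ⊢
        refine ⟨fun h => ?_, a, b, h2, by rwa [secondAtom_castSucc]⟩
        have h3 := congrArg Fin.val h
        simp only [Fin.val_castSucc] at h3
        omega
      · have ht : ¬ (downIndex i t).val < i.val := by
          have := t.isLt
          simp only [downIndex]; omega
        simp only [partner, testIndex, ht, if_false] at h2 ⊢
        refine ⟨fun h => ?_, a, b, by rwa [firstAtom_succ], h2⟩
        have h3 := congrArg Fin.val h
        simp only [Fin.val_succ] at h3
        omega
    · rintro ⟨hx, a, b, h1, h2⟩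
      rcases lt_or_gt_of_ne hx with hlt | hgt
      · have hlt' : x.val < i.val := hlt
        have hk : x.val < k := by omega
        -- The second atom is binary here, so it shows that both constants lie in `A`; reading it
        -- triggers the test of `x`.
        rw [secondAtom_of_lt x hk] at h2
        refine Or.inl ⟨a, hA _ h2 a (by simp [Fact.consts]), b,
          hA _ h2 b (by simp [Fact.consts]), ⟨x.val, hlt'⟩, ?_, h2, ?_⟩
        · simp only [testIndex, upIndex, hlt', if_true]; rfl
        · simp only [partner, upIndex, hlt', if_true]; exact h1
      · have hgt' : i.val < x.val := hgt
        rw [firstAtom_of_pos x (by omega)] at h1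
        -- Here the first atom is the binary fact that triggers the test. Counted from the last
        -- predicate, its position is `k - x`.
        have hd : downIndex i ⟨k - x.val, by omega⟩ = ⟨x.val - 1, by omega⟩ := by
          simp only [downIndex, Fin.mk.injEq]; omega
        have hge : ¬ x.val - 1 < i.val := by omega
        have hs : (⟨x.val - 1, by omega⟩ : Fin k).succ = x := by
          ext; simp only [Fin.val_succ]; omega
        refine Or.inr ⟨b, hA _ h1 b (by simp [Fact.consts]), a,
          hA _ h1 a (by simp [Fact.consts]), ⟨k - x.val, by omega⟩, ?_, by rw [hd]; exact h1, ?_⟩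
        · rw [hd]; simp only [testIndex, hge, if_false, hs]
        · rw [hd]; simp only [partner, hge, if_false, hs]; exact h2
  · intro t
    have ht : (upIndex i t).val < i.val := t.isLt
    simp only [isInitial, ht, if_true]; rfl
  · intro a b t
    have ht : (upIndex i t).val < i.val := t.isLt
    simp only [partner, ht, if_true]
    split_ifs with h0
    · have : (upIndex i t).castSucc = 0 := by ext; exact h0
      rw [this, firstAtom_zero]
    · rw [firstAtom_of_pos _ (by simp only [upIndex, Fin.val_castSucc]; omega)]; rfl
  · intro t
    have ht : ¬ (downIndex i t).val < i.val := by
      have := t.isLt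
      simp only [downIndex]; omega
    simp only [isInitial, ht, if_false, decide_eq_decide]
    have := t.isLt
    simp only [downIndex]; omega
  · intro b a t
    have hlt := t.isLt
    have ht : ¬ (downIndex i t).val < i.val := by simp only [downIndex]; omega
    simp only [partner, ht, if_false]
    split_ifs with h0
    · have : (downIndex i t).succ = Fin.last k := by
        ext; simp only [downIndex, Fin.val_succ, Fin.val_last]; omega
      rw [this, secondAtom_last]
    · rw [secondAtom_of_lt _ (by simp only [downIndex, Fin.val_succ]; omega)]
      congr 1
      simp only [downIndex, Fin.val_succ, Fin.mk.injEq]; omega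

/-- The order also lists facts that are absent from the database. They are read as false, which
keeps the order uniform. -/
theorem mem_factOrder (i : Fin (k + 1)) (A : List ℕ) (t : Fact k) :
    t ∈ factOrder i A ↔ ∀ a ∈ t.consts, a ∈ A := by
  rw [factOrder, List.mem_append]
  simp only [List.mem_flatMap, List.mem_cons, List.mem_ofFn]
  cases t with
  | R a => simp [Fact.consts]
  | T a => simp [Fact.consts]
  | S j a b =>
    simp only [Fact.consts, List.mem_cons, List.not_mem_nil, or_false, forall_eq_or_imp, forall_eq,
      reduceCtorEq, false_or, Fact.S.injEq]
    constructor
    · rintro (⟨c, hc, d, hd, t, -, rfl, rfl⟩ | ⟨c, hc, d, hd, t, -, rfl, rfl⟩) <;> exact ⟨‹_›, ‹_›⟩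
    · rintro ⟨ha, hb⟩
      by_cases h : j.val < i.val
      · exact Or.inl ⟨a, ha, b, hb, ⟨j, h⟩, rfl, rfl, rfl⟩
      · refine Or.inr ⟨b, hb, a, ha, ⟨k - 1 - j, by omega⟩, ?_, rfl, rfl⟩
        ext; simp only [downIndex]; omega

/-- Reading no fact twice is what yields decomposability of the circuits and independence in the
computation of probabilities. -/
theorem nodup_factOrder (i : Fin (k + 1)) {A : List ℕ} (hA : A.Nodup) :
    (factOrder i A).Nodup := by
  have hup : Function.Injective (upIndex i) := fun s t h => by
    ext; simpa [upIndex] using h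
  have hdown : Function.Injective (downIndex i) := fun s t h => by
    have h' : k - 1 - s.val = k - 1 - t.val := by simpa [downIndex] using h
    have := s.isLt
    have := t.isLt
    ext; omega
  rw [factOrder, List.nodup_append]
  refine ⟨?_, ?_, ?_⟩
  · rw [List.nodup_flatMap]
    refine ⟨fun a _ => ?_, hA.imp fun {a a'} hne => ?_⟩
    · rw [List.nodup_cons, List.nodup_flatMap]
      refine ⟨by simp [List.mem_ofFn], fun b _ => ?_, hA.imp fun {b b'} hne => ?_⟩
      · rw [List.nodup_ofFn]; intro s t h; simp only [Fact.S.injEq] at h; exact hup h.1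
      · intro t ht ht'
        simp only [List.mem_ofFn] at ht ht'
        obtain ⟨s, rfl⟩ := ht
        obtain ⟨s', h⟩ := ht'
        simp only [Fact.S.injEq] at h
        exact hne h.2.2.symm
    · intro t ht ht'
      simp only [List.mem_cons, List.mem_flatMap, List.mem_ofFn] at ht ht'
      rcases ht with rfl | ⟨b, -, s, rfl⟩ <;> simp_all
  · rw [List.nodup_flatMap]
    refine ⟨fun a _ => ?_, hA.imp fun {a a'} hne => ?_⟩
    · rw [List.nodup_cons, List.nodup_flatMap]
      refine ⟨by simp [List.mem_ofFn], fun b _ => ?_, hA.imp fun {b b'} hne => ?_⟩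
      · rw [List.nodup_ofFn]; intro s t h; simp only [Fact.S.injEq] at h; exact hdown h.1
      · intro t ht ht'
        simp only [List.mem_ofFn] at ht ht'
        obtain ⟨s, rfl⟩ := ht
        obtain ⟨s', h⟩ := ht'
        simp only [Fact.S.injEq] at h
        exact hne h.2.1.symm
    · intro t ht ht'
      simp only [List.mem_cons, List.mem_flatMap, List.mem_ofFn] at ht ht'
      rcases ht with rfl | ⟨b, -, s, rfl⟩ <;> simp_all
  · intro t ht t' ht' e
    subst e
    simp only [List.mem_flatMap, List.mem_cons, List.mem_ofFn] at ht ht'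
    obtain ⟨a, -, rfl | ⟨b, -, s, rfl⟩⟩ := ht <;> obtain ⟨a', -, h | ⟨b', -, s', h⟩⟩ := ht'
    all_goals simp only [reduceCtorEq, Fact.S.injEq] at h
    have h1 := congrArg Fin.val h.1
    have := s.isLt
    have := s'.isLt
    simp only [upIndex, downIndex] at h1
    omega

theorem length_factOrder_le (i : Fin (k + 1)) (A : List ℕ) :
    (factOrder i A).length ≤ 2 * (A.length * (A.length * k + 1)) := by
  have h1 := i.isLt
  have h2 : A.length * i.val ≤ A.length * k := Nat.mul_le_mul_left _ (by omega)
  have h3 : A.length * (k - i.val) ≤ A.length * k := Nat.mul_le_mul_left _ (by omega)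
  have h4 : A.length * (A.length * i.val + 1) ≤ A.length * (A.length * k + 1) :=
    Nat.mul_le_mul_left _ (by omega)
  have h5 : A.length * (A.length * (k - i.val) + 1) ≤ A.length * (A.length * k + 1) :=
    Nat.mul_le_mul_left _ (by omega)
  simp only [factOrder, List.length_append, List.length_flatMap, List.length_cons,
    List.length_ofFn, List.map_const', List.sum_replicate, smul_eq_mul]
  omega

end Automaton

/-! ### Extending circuits -/

section Circuits

variable {α : Type} [DecidableEq α]

omit [DecidableEq α] in
theorem all_congr_of_mem {l : List α} {p q : α → Bool} (h : ∀ a ∈ l, p a = q a) :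
    l.all p = l.all q := by
  induction l with
  | nil => rfl
  | cons a l ih => rw [List.all_cons, List.all_cons, h a (by simp), ih fun a ha => h a (by simp [ha])]

omit [DecidableEq α] in
theorem any_congr_of_mem {l : List α} {p q : α → Bool} (h : ∀ a ∈ l, p a = q a) :
    l.any p = l.any q := by
  induction l with
  | nil => rfl
  | cons a l ih => rw [List.any_cons, List.any_cons, h a (by simp), ih fun a ha => h a (by simp [ha])]

/-- The value of a gate in terms of the values of its inputs. -/
def Gate.value (ν : Finset α) (val : ℕ → Bool) : Gate α → Bool
  | .var t => decide (t ∈ ν)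
  | .not j => !val j
  | .and js => js.all val
  | .or js => js.any val

namespace Circuit

theorem eval_eq_value {C : Circuit α} {i : ℕ} {g : Gate α} (hg : C.gates[i]? = some g)
    (h : ∀ j ∈ g.inputs, j < i) (ν : Finset α) : C.eval ν i = g.value ν (C.eval ν) := by
  rw [eval, hg]
  cases g with
  | var t => rfl
  | not j => simp [Gate.value, h j (by simp [Gate.inputs])]
  | and js =>
    refine all_congr_of_mem fun j hj => ?_
    simp [h j hj]
  | or js =>
    refine any_congr_of_mem fun j hj => ?_
    simp [h j hj]

theorem eval_congr {C C' : Circuit α} (ν : Finset α) (i : ℕ)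
    (h : ∀ j ≤ i, C.gates[j]? = C'.gates[j]?) : C.eval ν i = C'.eval ν i := by
  induction i using Nat.strong_induction_on with
  | _ i ih =>
    have hj : ∀ j < i, C.eval ν j = C'.eval ν j := fun j hj =>
      ih j hj fun l hl => h l (by omega)
    rw [eval, eval, h i le_rfl]
    rcases C'.gates[i]? with _ | g
    · rfl
    cases g with
    | var t => rfl
    | not j => by_cases hji : j < i <;> simp [hji, hj]
    | and js =>
      refine all_congr_of_mem fun j _ => ?_
      by_cases hji : j < i <;> simp [hji, hj]
    | or js =>
      refine any_congr_of_mem fun j _ => ?_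
      by_cases hji : j < i <;> simp [hji, hj]

omit [DecidableEq α] in
theorem HasVar.congr {C C' : Circuit α}
    (hC : ∀ (i : ℕ) (g : Gate α), C.gates[i]? = some g → ∀ j ∈ g.inputs, j < i)
    {i : ℕ} {t : α} (ht : C.HasVar i t) (h : ∀ j ≤ i, C.gates[j]? = C'.gates[j]?) :
    C'.HasVar i t := by
  induction ht with
  | var hg => exact .var (by rw [← h _ le_rfl, hg])
  | wire hg hj _ ih =>
    have hlt := hC _ _ hg _ hj
    exact .wire (by rw [← h _ le_rfl, hg]) hj (ih fun l hl => h l (by omega))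

omit [DecidableEq α] in
theorem HasVar.cases_gate {C : Circuit α} {i : ℕ} {t : α} (ht : C.HasVar i t) {g : Gate α}
    (hg : C.gates[i]? = some g) : g = .var t ∨ ∃ j ∈ g.inputs, C.HasVar j t := by
  cases ht with
  | var h => exact Or.inl (by rw [hg] at h; exact Option.some.inj h)
  | wire h hj ht =>
    rw [hg] at h
    cases h
    exact Or.inr ⟨_, hj, ht⟩

/-- Determinism quantifies over all valuations, whereas a lineage is specified only on subsets of
`D`; intersecting with `D` bridges the gap. -/
theorem eval_inter {C : Circuit α} {D : Finset α} (hD : ∀ t, Gate.var t ∈ C.gates → t ∈ D)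
    (ν : Finset α) (i : ℕ) : C.eval (ν ∩ D) i = C.eval ν i := by
  induction i using Nat.strong_induction_on with
  | _ i ih =>
    rw [eval, eval]
    rcases hg : C.gates[i]? with _ | g
    · rfl
    cases g with
    | var t =>
      have := hD t (List.mem_of_getElem? hg)
      simp [this]
    | not j => by_cases hji : j < i <;> simp [hji, ih]
    | and js =>
      refine all_congr_of_mem fun j _ => ?_
      by_cases hji : j < i <;> simp [hji, ih]
    | or js =>
      refine any_congr_of_mem fun j _ => ?_
      by_cases hji : j < i <;> simp [hji, ih]

end Circuit

/-- The value of gate `i` in the list of gates `G`. -/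
def gateEval (G : List (Gate α)) (ν : Finset α) (i : ℕ) : Bool := Circuit.eval ⟨G, 0⟩ ν i

omit [DecidableEq α] in
/-- The variable `t` occurs below gate `i` in the list of gates `G`. -/
def GateHasVar (G : List (Gate α)) (i : ℕ) (t : α) : Prop := Circuit.HasVar ⟨G, 0⟩ i t

/-- The gates of a deterministic decomposable circuit with variables in `D`. -/
structure DDGates (D : Finset α) (G : List (Gate α)) : Prop where
  lt : ∀ (i : ℕ) (g : Gate α), G[i]? = some g → ∀ j ∈ g.inputs, j < i
  decomposable : ∀ (i : ℕ) (js : List ℕ), G[i]? = some (.and js) → ∀ j₁ ∈ js, ∀ j₂ ∈ js, j₁ ≠ j₂ →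
    ∀ t, ¬ (GateHasVar G j₁ t ∧ GateHasVar G j₂ t)
  deterministic : ∀ (i : ℕ) (js : List ℕ), G[i]? = some (.or js) → ∀ j₁ ∈ js, ∀ j₂ ∈ js, j₁ ≠ j₂ →
    ∀ ν : Finset α, ¬ (gateEval G ν j₁ = true ∧ gateEval G ν j₂ = true)
  var_mem : ∀ t, Gate.var t ∈ G → t ∈ D

theorem eval_eq_gateEval (C : Circuit α) (ν : Finset α) (i : ℕ) :
    C.eval ν i = gateEval C.gates ν i :=
  Circuit.eval_congr ν i fun _ _ => rfl

theorem gateEval_append (G G' : List (Gate α)) (ν : Finset α) {i : ℕ} (hi : i < G.length) :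
    gateEval (G ++ G') ν i = gateEval G ν i :=
  Circuit.eval_congr ν i fun _ hj => List.getElem?_append_left (hj.trans_lt hi)

/-- The output number matters only for its range. Separating it off lets circuits grow by appending
to the list of gates. -/
theorem ddGates_iff (D : Finset α) (C : Circuit α) :
    (C.IsDD ∧ ∀ t, Gate.var t ∈ C.gates → t ∈ D) ↔ DDGates D C.gates ∧ C.out < C.gates.length := by
  constructor
  · rintro ⟨⟨⟨h1, h2⟩, h3, h4⟩, h5⟩
    refine ⟨⟨h2, fun i js hg j₁ hj₁ j₂ hj₂ hne t ht => ?_,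
      fun i js hg j₁ hj₁ j₂ hj₂ hne ν hν => ?_, h5⟩, h1⟩
    · exact h3 i js hg j₁ hj₁ j₂ hj₂ hne t ⟨ht.1.congr (C := ⟨C.gates, 0⟩) h2 fun _ _ => rfl,
        ht.2.congr (C := ⟨C.gates, 0⟩) h2 fun _ _ => rfl⟩
    · rw [← eval_eq_gateEval, ← eval_eq_gateEval] at hν
      exact h4 i js hg j₁ hj₁ j₂ hj₂ hne ν hν
  · rintro ⟨⟨h2, h3, h4, h5⟩, h1⟩
    refine ⟨⟨⟨h1, h2⟩, fun i js hg j₁ hj₁ j₂ hj₂ hne t ht => ?_,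
      fun i js hg j₁ hj₁ j₂ hj₂ hne ν hν => ?_⟩, h5⟩
    · exact h3 i js hg j₁ hj₁ j₂ hj₂ hne t ⟨ht.1.congr h2 fun _ _ => rfl,
        ht.2.congr h2 fun _ _ => rfl⟩
    · rw [eval_eq_gateEval, eval_eq_gateEval] at hν
      exact h4 i js hg j₁ hj₁ j₂ hj₂ hne ν hν

namespace DDGates

variable {D : Finset α} {G : List (Gate α)}

theorem eval_eq (h : DDGates D G) {i : ℕ} {g : Gate α} (hg : G[i]? = some g) (ν : Finset α) :
    gateEval G ν i = g.value ν (gateEval G ν) :=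
  Circuit.eval_eq_value hg (h.lt i g hg) ν

theorem eval_inter (h : DDGates D G) (ν : Finset α) (i : ℕ) :
    gateEval G (ν ∩ D) i = gateEval G ν i := Circuit.eval_inter h.var_mem ν i


/-- Appending a layer of gates. -/
theorem append (h : DDGates D G) (L : List (Gate α)) (hlt : ∀ g ∈ L, ∀ j ∈ g.inputs, j < G.length)
    (hand : ∀ js, Gate.and js ∈ L → ∀ j₁ ∈ js, ∀ j₂ ∈ js, j₁ ≠ j₂ →
      ∀ t, GateHasVar G j₁ t → ¬ GateHasVar G j₂ t)
    (hor : ∀ js, Gate.or js ∈ L → ∀ j₁ ∈ js, ∀ j₂ ∈ js, j₁ ≠ j₂ →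
      ∀ ν : Finset α, ¬ (gateEval G ν j₁ = true ∧ gateEval G ν j₂ = true))
    (hvar : ∀ t, Gate.var t ∈ L → t ∈ D) : DDGates D (G ++ L) := by
  have hsplit : ∀ (i : ℕ) (g : Gate α), (G ++ L)[i]? = some g →
      (i < G.length ∧ G[i]? = some g) ∨ (G.length ≤ i ∧ g ∈ L) := fun i g hg => by
    rcases lt_or_ge i G.length with hi | hi
    · rw [List.getElem?_append_left hi] at hg
      exact Or.inl ⟨hi, hg⟩
    · rw [List.getElem?_append_right hi] at hg
      exact Or.inr ⟨hi, List.mem_of_getElem? hg⟩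
  -- All wires, including those of the new layer, start in `G`. Values and dependencies of inputs
  -- can therefore be computed in `G` alone.
  have hlt' : ∀ (i : ℕ) (g : Gate α), (G ++ L)[i]? = some g → ∀ j ∈ g.inputs, j < i ∧
      j < G.length := fun i g hg j hj => by
    rcases hsplit i g hg with ⟨hi, hg⟩ | ⟨hi, hg⟩
    · have := h.lt i g hg j hj
      omega
    · have := hlt g hg j hj
      omega
  have hv : ∀ {j t}, j < G.length → GateHasVar (G ++ L) j t → GateHasVar G j t :=
    fun {j t} hj ht => ht.congr (fun i g hg j hj => (hlt' i g hg j hj).1)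
      fun l hl => List.getElem?_append_left (by omega)
  refine ⟨fun i g hg j hj => (hlt' i g hg j hj).1, fun i js hg j₁ hj₁ j₂ hj₂ hne t ht => ?_,
    fun i js hg j₁ hj₁ j₂ hj₂ hne ν hν => ?_, fun t ht => ?_⟩
  · have h1 := hv (hlt' i _ hg j₁ hj₁).2 ht.1
    have h2 := hv (hlt' i _ hg j₂ hj₂).2 ht.2
    rcases hsplit i _ hg with ⟨-, hg⟩ | ⟨-, hg⟩
    · exact h.decomposable i js hg j₁ hj₁ j₂ hj₂ hne t ⟨h1, h2⟩
    · exact hand js hg j₁ hj₁ j₂ hj₂ hne t h1 h2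
  · rw [gateEval_append _ _ _ (hlt' i _ hg j₁ hj₁).2,
      gateEval_append _ _ _ (hlt' i _ hg j₂ hj₂).2] at hν
    rcases hsplit i _ hg with ⟨-, hg⟩ | ⟨-, hg⟩
    · exact h.deterministic i js hg j₁ hj₁ j₂ hj₂ hne ν hν
    · exact hor js hg j₁ hj₁ j₂ hj₂ hne ν hν
  · rcases List.mem_append.1 ht with ht | ht
    · exact h.var_mem t ht
    · exact hvar t ht

theorem hasVar_append (h : DDGates D (G ++ L)) {i : ℕ} (hi : i < G.length) {t : α}
    (ht : GateHasVar (G ++ L) i t) : GateHasVar G i t :=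
  ht.congr h.lt fun l hl => List.getElem?_append_left (by omega)

theorem hasVar_cases (_ : DDGates D G) {i : ℕ} {t : α} (ht : GateHasVar G i t) {g : Gate α}
    (hg : G[i]? = some g) : g = .var t ∨ ∃ j ∈ g.inputs, GateHasVar G j t :=
  Circuit.HasVar.cases_gate ht hg


end DDGates

/-! ### Circuits of automata -/

section Layers

variable {m : ℕ}

/-- Gates that test the last state. -/
def acceptLayer (acc : Fin m → Bool) : List (Gate α) :=
  List.ofFn fun s => if acc s then .and [] else .or []

/-- The gates for one step of an automaton with transition function `δ`, on reading the variable
`t` (or the constant false, if `present` is false), when there are already `n` gates, of which the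
last `m` ones capture acceptance from each state after the step. -/
def stepLayer (δ : Fin m → Bool → Fin m) (present : Bool) (n : ℕ) (t : α) : List (Gate α) :=
  (if present then .var t else .or []) :: .not n ::
    ((List.ofFn fun s => Gate.and [n, n - m + δ s true]) ++
      ((List.ofFn fun s => Gate.and [n + 1, n - m + δ s false]) ++
        List.ofFn fun s : Fin m => Gate.or [n + 2 + s, n + 2 + m + s]))

omit [DecidableEq α] in
theorem length_stepLayer (δ : Fin m → Bool → Fin m) (present : Bool) (n : ℕ) (t : α) :
    (stepLayer δ present n t).length = 2 + 3 * m := by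
  simp [stepLayer]; omega

/-- The last `m` gates capture the functions `F s`, and depend on variables in `T` only. -/
structure Captures (D : Finset α) (G : List (Gate α)) (T : Set α)
    (F : Fin m → Finset α → Bool) : Prop where
  dd : DDGates D G
  le : m ≤ G.length
  eval : ∀ (s : Fin m) ν, gateEval G ν (G.length - m + s) = F s ν
  mem : ∀ (s : Fin m) t, GateHasVar G (G.length - m + s) t → t ∈ T

theorem captures_acceptLayer {D : Finset α} {G : List (Gate α)} (h : DDGates D G)
    (acc : Fin m → Bool) : Captures D (G ++ acceptLayer acc) ∅ fun s _ => acc s := by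
  have hdd : DDGates D (G ++ acceptLayer acc) := by
    refine h.append _ ?_ ?_ ?_ ?_ <;> simp only [acceptLayer, List.mem_ofFn]
    · rintro _ ⟨s, rfl⟩ j hj
      cases h : acc s <;> simp [Gate.inputs, h] at hj
    · rintro js ⟨s, hs⟩ j hj
      cases h : acc s <;> simp [h] at hs
      subst hs; simp at hj
    · rintro js ⟨s, hs⟩ j hj
      cases h : acc s <;> simp [h] at hs
      subst hs; simp at hj
    · rintro t ⟨s, hs⟩
      cases h : acc s <;> simp [h] at hs
  have hlen : (G ++ acceptLayer acc).length - m = G.length := by simp [acceptLayer]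
  have hget : ∀ s : Fin m, (G ++ acceptLayer acc)[G.length + s]? =
      some (if acc s then .and [] else .or []) := fun s => by
    simp [acceptLayer]
  refine ⟨hdd, by simp [acceptLayer], fun s ν => ?_, fun s t ht => ?_⟩
  · rw [hlen, hdd.eval_eq (hget s)]
    cases acc s <;> simp [Gate.value]
  · rw [hlen] at ht
    rcases hdd.hasVar_cases ht (hget s) with h | ⟨j, hj, -⟩
    · cases h' : acc s <;> simp [h'] at h
    · cases h' : acc s <;> simp [h', Gate.inputs] at hj

/-- Shannon expansion on `t`: state `s` gets `(t ∧ F (δ s true)) ∨ (¬t ∧ F (δ s false))`. The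
conjunctions are decomposable because `t ∉ T`, and the disjunctions are deterministic because their
inputs disagree on `t`. The new gates are the variable at `n`, its negation at `n + 1`, the two rows
of conjunctions from `n + 2` and `n + 2 + m`, and the disjunctions last. -/
theorem Captures.step {D : Finset α} {G : List (Gate α)} {T : Set α}
    {F : Fin m → Finset α → Bool} (h : Captures D G T F) (δ : Fin m → Bool → Fin m) {t : α}
    (ht : t ∉ T) :
    Captures D (G ++ stepLayer δ (decide (t ∈ D)) G.length t) (insert t T)
      fun s ν => F (δ s (decide (t ∈ ν) && decide (t ∈ D))) ν := by
  obtain ⟨hdd, hle, hev, hmem⟩ := h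
  set n := G.length with hn
  set v : Gate α := if decide (t ∈ D) then .var t else .or [] with hv
  have hb : ∀ s : Fin m, n - m + s < n := fun s => by omega
  -- the gate for the variable
  have d1 : DDGates D (G ++ [v]) := by
    refine hdd.append _ ?_ ?_ ?_ ?_ <;> simp only [List.mem_singleton, hv]
    · rintro _ rfl j hj
      by_cases h : t ∈ D <;> simp [h, Gate.inputs] at hj
    · rintro js hs j hj
      by_cases h : t ∈ D <;> simp [h] at hs
    · rintro js hs j hj
      by_cases h : t ∈ D <;> simp [h] at hs
      simp [hs] at hj
    · rintro t' hs
      by_cases h : t ∈ D <;> simp [h] at hs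
      exact hs ▸ h
  have g1 : (G ++ [v])[n]? = some v := by simp [hn]
  have e1 : ∀ ν, gateEval (G ++ [v]) ν n = (decide (t ∈ ν) && decide (t ∈ D)) := fun ν => by
    rw [d1.eval_eq g1, hv]
    by_cases h : t ∈ D <;> simp [h, Gate.value]
  have v1 : ∀ t', GateHasVar (G ++ [v]) n t' → t' = t := fun t' h' => by
    rcases d1.hasVar_cases h' g1 with h | ⟨j, hj, -⟩ <;> by_cases h'' : t ∈ D
    · simpa [hv, h'', eq_comm] using h
    · simp [hv, h''] at h
    · simp [hv, h'', Gate.inputs] at hj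
    · simp [hv, h'', Gate.inputs] at hj
  -- the negated variable
  have d2 : DDGates D ((G ++ [v]) ++ [Gate.not n]) := by
    refine d1.append _ ?_ ?_ ?_ ?_ <;> simp [Gate.inputs, hn]
  have g2 : ((G ++ [v]) ++ [Gate.not n])[n + 1]? = some (.not n) := by simp [hn]
  have l2 : ((G ++ [v]) ++ [Gate.not n]).length = n + 2 := by simp [hn]
  set G2 := (G ++ [v]) ++ [.not n] with hG2
  have e2 : ∀ ν, gateEval G2 ν n = (decide (t ∈ ν) && decide (t ∈ D)) := fun ν => by
    rw [hG2, gateEval_append _ _ _ (by simp [hn]), e1]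
  have e2' : ∀ ν, gateEval G2 ν (n + 1) = !(decide (t ∈ ν) && decide (t ∈ D)) := fun ν => by
    rw [d2.eval_eq g2, Gate.value, e2]
  have v2 : ∀ t', GateHasVar G2 n t' → t' = t := fun t' h' =>
    v1 t' (d2.hasVar_append (by simp [hn]) h')
  have v2' : ∀ t', GateHasVar G2 (n + 1) t' → t' = t := fun t' h' => by
    rcases d2.hasVar_cases h' g2 with h | ⟨j, hj, h⟩
    · simp at h
    · simp only [Gate.inputs, List.mem_singleton] at hj
      exact v2 t' (hj ▸ h)
  have e2s : ∀ (s : Fin m) ν, gateEval G2 ν (n - m + s) = F s ν := fun s ν => by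
    rw [hG2, List.append_assoc, gateEval_append _ _ _ (hb s), hev]
  have v2s : ∀ (s : Fin m) t', GateHasVar G2 (n - m + s) t' → t' ∈ T := fun s t' h' => by
    rw [hG2, List.append_assoc] at h'
    rw [hG2, List.append_assoc] at d2
    exact hmem s t' (d2.hasVar_append (hb s) h')
  -- the conjunctions
  set A : List (Gate α) := (List.ofFn fun s => Gate.and [n, n - m + δ s true]) ++
    (List.ofFn fun s => Gate.and [n + 1, n - m + δ s false]) with hA
  have hmemA : ∀ g ∈ A, ∃ s, g = .and [n, n - m + δ s true] ∨ g = .and [n + 1, n - m + δ s false] :=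
    fun g hg => by
      rw [hA, List.mem_append, List.mem_ofFn, List.mem_ofFn] at hg
      rcases hg with ⟨s, rfl⟩ | ⟨s, rfl⟩
      · exact ⟨s, Or.inl rfl⟩
      · exact ⟨s, Or.inr rfl⟩
  have lA : A.length = 2 * m := by simp [hA]; omega
  have d3 : DDGates D (G2 ++ A) := by
    refine d2.append _ ?_ ?_ ?_ ?_
    · intro g hg j hj
      obtain ⟨s, rfl | rfl⟩ := hmemA g hg <;>
        simp only [Gate.inputs, List.mem_cons, List.not_mem_nil, or_false] at hj
      · have := hb (δ s true)
        omega
      · have := hb (δ s false)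
        omega
    · intro js hjs j₁ hj₁ j₂ hj₂ hne t' h1 h2
      obtain ⟨s, hs | hs⟩ := hmemA _ hjs <;> cases hs <;>
        simp only [List.mem_cons, List.not_mem_nil, or_false] at hj₁ hj₂ <;>
        rcases hj₁ with rfl | rfl <;> rcases hj₂ with rfl | rfl
      · exact hne rfl
      · exact ht (v2 _ h1 ▸ v2s _ _ h2)
      · exact ht (v2 _ h2 ▸ v2s _ _ h1)
      · exact hne rfl
      · exact hne rfl
      · exact ht (v2' _ h1 ▸ v2s _ _ h2)
      · exact ht (v2' _ h2 ▸ v2s _ _ h1)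
      · exact hne rfl
    · intro js hjs
      obtain ⟨s, hs | hs⟩ := hmemA _ hjs <;> cases hs
    · intro t' ht'
      obtain ⟨s, hs | hs⟩ := hmemA _ ht' <;> cases hs
  have g3 : ∀ s : Fin m, (G2 ++ A)[n + 2 + s]? = some (.and [n, n - m + δ s true]) := fun s => by
    rw [List.getElem?_append_right (by omega), l2, hA,
      List.getElem?_append_left (by simp), Nat.add_sub_cancel_left]
    simp
  have g3' : ∀ s : Fin m, (G2 ++ A)[n + 2 + m + s]? = some (.and [n + 1, n - m + δ s false]) :=
    fun s => by
      rw [List.getElem?_append_right (by omega), l2, hA,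
        List.getElem?_append_right (by simp; omega), List.length_ofFn,
        show n + 2 + m + s - (n + 2) - m = s by omega]
      simp
  have l3 : (G2 ++ A).length = n + 2 + 2 * m := by rw [List.length_append, l2, lA]
  have e3 : ∀ (s : Fin m) ν, gateEval (G2 ++ A) ν (n + 2 + s) =
      ((decide (t ∈ ν) && decide (t ∈ D)) && F (δ s true) ν) := fun s ν => by
    have := hb (δ s true)
    rw [d3.eval_eq (g3 s)]
    simp only [Gate.value, List.all_cons, List.all_nil, Bool.and_true]
    rw [gateEval_append G2 A _ (by omega), gateEval_append G2 A _ (by omega), e2, e2s]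
  have e3' : ∀ (s : Fin m) ν, gateEval (G2 ++ A) ν (n + 2 + m + s) =
      (!(decide (t ∈ ν) && decide (t ∈ D)) && F (δ s false) ν) := fun s ν => by
    have := hb (δ s false)
    rw [d3.eval_eq (g3' s)]
    simp only [Gate.value, List.all_cons, List.all_nil, Bool.and_true]
    rw [gateEval_append G2 A _ (by omega), gateEval_append G2 A _ (by omega), e2', e2s]
  have v3 : ∀ (s : Fin m) t', GateHasVar (G2 ++ A) (n + 2 + s) t' ∨
      GateHasVar (G2 ++ A) (n + 2 + m + s) t' → t' ∈ insert t T := by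
    have := fun s => hb (δ s true)
    have := fun s => hb (δ s false)
    rintro s t' (h' | h')
    · rcases d3.hasVar_cases h' (g3 s) with h | ⟨j, hj, h⟩
      · simp at h
      · simp only [Gate.inputs, List.mem_cons, List.not_mem_nil, or_false] at hj
        rcases hj with rfl | rfl
        · exact Or.inl (v2 _ (d3.hasVar_append (by omega) h))
        · exact Or.inr (v2s _ _ (d3.hasVar_append (by have := hb (δ s true); omega) h))
    · rcases d3.hasVar_cases h' (g3' s) with h | ⟨j, hj, h⟩
      · simp at h
      · simp only [Gate.inputs, List.mem_cons, List.not_mem_nil, or_false] at hj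
        rcases hj with rfl | rfl
        · exact Or.inl (v2' _ (d3.hasVar_append (by omega) h))
        · exact Or.inr (v2s _ _ (d3.hasVar_append (by have := hb (δ s false); omega) h))
  -- the disjunctions
  set B : List (Gate α) := List.ofFn fun s : Fin m => Gate.or [n + 2 + s, n + 2 + m + s] with hB
  have d4 : DDGates D ((G2 ++ A) ++ B) := by
    refine d3.append _ ?_ ?_ ?_ ?_ <;> simp only [hB, List.mem_ofFn]
    · rintro _ ⟨s, rfl⟩ j hj
      simp only [Gate.inputs, List.mem_cons, List.not_mem_nil, or_false] at hj
      omega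
    · rintro js ⟨s, hs⟩
      cases hs
    · rintro js ⟨s, hs⟩ j₁ hj₁ j₂ hj₂ hne ν ⟨h1, h2⟩
      cases hs
      simp only [List.mem_cons, List.not_mem_nil, or_false] at hj₁ hj₂
      rcases hj₁ with rfl | rfl <;> rcases hj₂ with rfl | rfl
      · exact hne rfl
      · rw [e3] at h1; rw [e3'] at h2
        cases h : (decide (t ∈ ν) && decide (t ∈ D)) <;> simp [h] at h1 h2
      · rw [e3'] at h1; rw [e3] at h2
        cases h : (decide (t ∈ ν) && decide (t ∈ D)) <;> simp [h] at h1 h2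
      · exact hne rfl
    · rintro t' ⟨s, hs⟩
      cases hs
  have hG : G ++ stepLayer δ (decide (t ∈ D)) n t = (G2 ++ A) ++ B := by
    simp [stepLayer, hG2, hA, hB, hv]
  have g4 : ∀ s : Fin m, ((G2 ++ A) ++ B)[n + 2 + 2 * m + s]? =
      some (.or [n + 2 + s, n + 2 + m + s]) := fun s => by
    rw [List.getElem?_append_right (by omega), l3, Nat.add_sub_cancel_left, hB]
    simp
  have l4 : ((G2 ++ A) ++ B).length - m = n + 2 + 2 * m := by
    rw [List.length_append, l3, hB, List.length_ofFn]; omega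
  rw [hG]
  refine ⟨d4, by rw [List.length_append, hB, List.length_ofFn]; omega, fun s ν => ?_,
    fun s t' h' => ?_⟩
  · rw [l4, d4.eval_eq (g4 s)]
    simp only [Gate.value, List.any_cons, List.any_nil, Bool.or_false]
    rw [gateEval_append (G2 ++ A) B _ (by omega), gateEval_append (G2 ++ A) B _ (by omega), e3, e3']
    cases (decide (t ∈ ν) && decide (t ∈ D)) <;> simp
  · rw [l4] at h'
    rcases d4.hasVar_cases h' (g4 s) with h | ⟨j, hj, h⟩
    · simp at h
    · simp only [Gate.inputs, List.mem_cons, List.not_mem_nil, or_false] at hj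
      rcases hj with rfl | rfl
      · exact v3 s t' (Or.inl (d4.hasVar_append (by omega) h))
      · exact v3 s t' (Or.inr (d4.hasVar_append (by omega) h))

/-- The gates `G`, followed by a circuit for an automaton that reads the variables of `L`. -/
def automatonGates (δ : α → Fin m → Bool → Fin m) (acc : Fin m → Bool) (D : Finset α)
    (L : List α) (G : List (Gate α)) : List (Gate α) :=
  L.reverse.foldl (fun G t => G ++ stepLayer (δ t) (decide (t ∈ D)) G.length t)
    (G ++ acceptLayer acc)

theorem automatonGates_cons (δ : α → Fin m → Bool → Fin m) (acc : Fin m → Bool) (D : Finset α)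
    (t : α) (L : List α) (G : List (Gate α)) :
    automatonGates δ acc D (t :: L) G = automatonGates δ acc D L G ++
      stepLayer (δ t) (decide (t ∈ D)) (automatonGates δ acc D L G).length t := by
  simp [automatonGates]

/-- The layers are built from the last variable to the first, so each one captures acceptance of the
rest of the list from every state. The absence of repetitions supplies `t ∉ T` at each step. -/
theorem captures_automatonGates (δ : α → Fin m → Bool → Fin m) (acc : Fin m → Bool) {D : Finset α}
    {L : List α} (hL : L.Nodup) {G : List (Gate α)} (h : DDGates D G) :
    Captures D (automatonGates δ acc D L G) {t | t ∈ L} fun s ν =>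
      acc (L.foldl (fun s t => δ t s (decide (t ∈ ν) && decide (t ∈ D))) s) := by
  induction L with
  | nil =>
    have := captures_acceptLayer h acc
    simpa [automatonGates] using this
  | cons t L ih =>
    rw [List.nodup_cons] at hL
    have h1 := (ih hL.2).step (δ t) (t := t) hL.1
    have hset : {t' | t' ∈ t :: L} = insert t {t' | t' ∈ L} := by
      ext t'
      simp
    rw [automatonGates_cons, hset]
    exact h1

/-- The gates of `G` keep their numbers and values, so the output of the circuit being extended
remains available. -/
theorem automatonGates_prefix (δ : α → Fin m → Bool → Fin m) (acc : Fin m → Bool) (D : Finset α)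
    (L : List α) (G : List (Gate α)) : ∃ G', automatonGates δ acc D L G = G ++ G' := by
  induction L with
  | nil => exact ⟨_, rfl⟩
  | cons t L ih =>
    obtain ⟨G', h⟩ := ih
    rw [automatonGates_cons]
    exact ⟨_, by rw [h, List.append_assoc]⟩

/-- Number of gates plus number of wires. -/
def gatesSize (G : List (Gate α)) : ℕ := (G.map fun g => 1 + g.inputs.length).sum

omit [DecidableEq α] in
theorem gatesSize_append (G G' : List (Gate α)) :
    gatesSize (G ++ G') = gatesSize G + gatesSize G' := by simp [gatesSize]

omit [DecidableEq α] in
theorem gatesSize_le {G : List (Gate α)} {c : ℕ} (h : ∀ g ∈ G, g.inputs.length ≤ c) :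
    gatesSize G ≤ G.length * (1 + c) := by
  refine (List.sum_le_card_nsmul _ (1 + c) ?_).trans (by simp)
  simpa using h

theorem gatesSize_automatonGates (δ : α → Fin m → Bool → Fin m) (acc : Fin m → Bool)
    (D : Finset α) (L : List α) (G : List (Gate α)) :
    gatesSize (automatonGates δ acc D L G) ≤ gatesSize G + 3 * m + L.length * (3 * (2 + 3 * m)) := by
  induction L with
  | nil =>
    have h1 : gatesSize (acceptLayer (α := α) acc) ≤ m * (1 + 0) := by
      refine (gatesSize_le (c := 0) ?_).trans (by simp [acceptLayer])
      simp only [acceptLayer, List.mem_ofFn]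
      rintro _ ⟨s, rfl⟩
      cases acc s <;> simp [Gate.inputs]
    simp only [automatonGates, List.reverse_nil, List.foldl_nil, gatesSize_append]
    omega
  | cons t L ih =>
    rw [automatonGates_cons, gatesSize_append, List.length_cons, add_mul]
    have h1 : gatesSize (stepLayer (δ t) (decide (t ∈ D)) (automatonGates δ acc D L G).length t)
        ≤ (2 + 3 * m) * (1 + 2) := by
      refine (gatesSize_le (c := 2) ?_).trans (by rw [length_stepLayer])
      simp only [stepLayer, List.mem_cons, List.mem_append, List.mem_ofFn]
      rintro _ (rfl | rfl | ⟨s, rfl⟩ | ⟨s, rfl⟩ | ⟨s, rfl⟩)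
      · by_cases h : t ∈ D <;> simp [Gate.inputs, h]
      all_goals simp [Gate.inputs]
    omega

end Layers

end Circuits

/-! ### The circuits for the queries that are satisfied by two adjacent valuations -/

section PairQueries

variable {k : ℕ}

/-- The number of states. -/
abbrev numStates (k : ℕ) : ℕ := Fintype.card (State k)

/-- An enumeration of the states. -/
noncomputable def stateEquiv (k : ℕ) : State k ≃ Fin (numStates k) := Fintype.equivFin _

/-- The transition function on numbered states. -/
noncomputable def delta (i : Fin (k + 1)) (c : Option (Fin k)) (s : Fin (numStates k)) (v : Bool) :
    Fin (numStates k) := stateEquiv k (((stateEquiv k).symm s).step i c v)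

/-- The accepting states. -/
noncomputable def accepts (ν : Finset (Fin (k + 1))) (s : Fin (numStates k)) : Bool :=
  decide (((stateEquiv k).symm s).1 = ν)

/-- The initial state. -/
noncomputable def startState (k : ℕ) : Fin (numStates k) := stateEquiv k (∅, false, false)

theorem foldl_delta (i : Fin (k + 1)) (W : Database k) (L : List (Fact k)) (s : State k) :
    L.foldl (fun s t => delta i t.kind s (decide (t ∈ W))) (stateEquiv k s) =
      stateEquiv k (s.run i W L) := by
  induction L generalizing s with
  | nil => rfl
  | cons t L ih =>
    rw [List.foldl_cons, State.run_cons, ← ih]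
    simp [delta]

/-- The constants of a list of facts. -/
def listConsts (l : List (Fact k)) : List ℕ := dedupFold (l.flatMap Fact.consts)

theorem mem_listConsts (l : List (Fact k)) (a : ℕ) :
    a ∈ listConsts l ↔ ∃ t ∈ l, a ∈ t.consts := by
  rw [listConsts, (dedupFold_spec _).2.1, List.mem_flatMap]

theorem nodup_listConsts (l : List (Fact k)) : (listConsts l).Nodup := (dedupFold_spec _).1

theorem length_listConsts_le (l : List (Fact k)) : (listConsts l).length ≤ 2 * l.length := by
  refine (dedupFold_spec _).2.2.trans ?_
  rw [List.length_flatMap, mul_comm]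
  refine (List.sum_le_card_nsmul _ 2 ?_).trans (by simp)
  simp only [List.mem_map]
  rintro _ ⟨t, -, rfl⟩
  cases t <;> simp [Fact.consts]

open Classical in
/-- The query variables that are true in `W`. -/
noncomputable def satisfied (W : Database k) : Finset (Fin (k + 1)) := {j | hk j W}

theorem hQuery_iff (φ : BoolFun (Fin (k + 1))) (W : Database k) :
    hQuery φ W ↔ φ (satisfied W) = true := Iff.rfl

/-- The order in which the facts are read. -/
def readOrder (i : Fin (k + 1)) (l : List (Fact k)) : List (Fact k) := factOrder i (listConsts l)

theorem nodup_readOrder (i : Fin (k + 1)) (l : List (Fact k)) : (readOrder i l).Nodup :=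
  nodup_factOrder i (nodup_listConsts l)

theorem mem_readOrder (i : Fin (k + 1)) {l : List (Fact k)} {t : Fact k} (h : t ∈ l) :
    t ∈ readOrder i l :=
  (mem_factOrder i _ t).2 fun a ha => (mem_listConsts l a).2 ⟨t, h, ha⟩

/-- The final state records the satisfied queries other than `i`, which is all that membership in
the pair `ν`, `insert i ν` depends on when `i ∉ ν`. -/
theorem accepts_readOrder (i : Fin (k + 1)) (ν : Finset (Fin (k + 1))) (l : List (Fact k))
    (W : Database k) (hW : W ⊆ l.toFinset) :
    accepts ν ((readOrder i l).foldl (fun s t => delta i t.kind s (decide (t ∈ W)))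
      (startState k)) = decide ((satisfied W).erase i = ν) := by
  rw [startState, foldl_delta, accepts, Equiv.symm_apply_apply]
  congr 2
  ext x
  rw [readOrder, State.mem_run_factOrder, Finset.mem_erase, satisfied]
  · simp
  · intro t ht a ha
    exact (mem_listConsts l a).2 ⟨t, List.mem_toFinset.1 (hW ht), ha⟩

/-- The gates `G`, followed by a circuit whose `numStates k` last gates capture acceptance of the
valuations `ν` and `insert i ν`. -/
noncomputable def pairGates (i : Fin (k + 1)) (ν : Finset (Fin (k + 1))) (l : List (Fact k))
    (G : List (Gate (Fact k))) : List (Gate (Fact k)) :=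
  automatonGates (fun t => delta i t.kind) (accepts ν) l.toFinset (readOrder i l) G

/-- The circuit `C`, with an additional gate for its negation. -/
def notCircuit (C : Circuit (Fact k)) : Circuit (Fact k) :=
  ⟨C.gates ++ [.not C.out], C.gates.length⟩

/-- The disjunction of `C` with the query for the valuations `ν` and `insert i ν`. -/
noncomputable def addCircuit (i : Fin (k + 1)) (ν : Finset (Fin (k + 1))) (l : List (Fact k))
    (C : Circuit (Fact k)) : Circuit (Fact k) :=
  ⟨pairGates i ν l C.gates ++
    [.or [C.out, (pairGates i ν l C.gates).length - numStates k + startState k]],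
    (pairGates i ν l C.gates).length⟩

/-- `C` is a d-D for the lineage of the query of `φ` on `D`. -/
def IsDDFor (φ : BoolFun (Fin (k + 1))) (D : Database k) (C : Circuit (Fact k)) : Prop :=
  C.IsDD ∧ C.RepresentsLineage (hQuery φ) D

theorem isDDFor_iff (φ : BoolFun (Fin (k + 1))) (D : Database k) (C : Circuit (Fact k)) :
    IsDDFor φ D C ↔ DDGates D C.gates ∧ C.out < C.gates.length ∧
      ∀ W ⊆ D, gateEval C.gates W C.out = φ (satisfied W) := by
  rw [← and_assoc, ← ddGates_iff, IsDDFor, Circuit.RepresentsLineage, and_assoc]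
  refine and_congr_right fun _ => and_congr_right fun _ => forall₂_congr fun W _ => ?_
  rw [hQuery_iff, eval_eq_gateEval]
  exact Bool.eq_iff_iff.symm

theorem IsDDFor.notCircuit {φ : BoolFun (Fin (k + 1))} {D : Database k} {C : Circuit (Fact k)}
    (h : IsDDFor φ D C) : IsDDFor (fun ν => !φ ν) D (notCircuit C) := by
  rw [isDDFor_iff] at h ⊢
  obtain ⟨h1, h2, h3⟩ := h
  have d : DDGates D (C.gates ++ [.not C.out]) := by
    refine h1.append _ ?_ ?_ ?_ ?_ <;> simp [Gate.inputs, h2]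
  have g : (C.gates ++ [.not C.out])[C.gates.length]? = some (.not C.out) := by simp
  refine ⟨d, by simp [HQ.notCircuit], fun W hW => ?_⟩
  change gateEval (C.gates ++ [.not C.out]) W C.gates.length = _
  rw [d.eval_eq g, Gate.value, gateEval_append _ _ _ h2, h3 W hW]

/-- The added `∨`-gate is deterministic because `φ` is false at `ν` and at `insert i ν`, the only
valuations accepted by the automaton. -/
theorem IsDDFor.addCircuit {φ : BoolFun (Fin (k + 1))} {C : Circuit (Fact k)}
    {l : List (Fact k)} (h : IsDDFor φ l.toFinset C) {i : Fin (k + 1)} {ν : Finset (Fin (k + 1))}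
    (hi : i ∉ ν) (hν : φ ν = false) (hν' : φ (insert i ν) = false) :
    IsDDFor (fun μ => φ μ || decide (μ.erase i = ν)) l.toFinset (addCircuit i ν l C) := by
  rw [isDDFor_iff] at h ⊢
  obtain ⟨h1, h2, h3⟩ := h
  have hc := captures_automatonGates (fun t : Fact k => delta i t.kind) (accepts ν)
    (nodup_readOrder i l) h1
  obtain ⟨G', hG'⟩ := automatonGates_prefix (fun t : Fact k => delta i t.kind) (accepts ν)
    l.toFinset (readOrder i l) C.gates
  change Captures _ (pairGates i ν l C.gates) _ _ at hc
  change pairGates i ν l C.gates = _ at hG'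
  set G := pairGates i ν l C.gates with hG
  set o := G.length - numStates k + startState k with ho
  have hlen : C.gates.length ≤ G.length := by rw [hG', List.length_append]; omega
  have hlo : o < G.length := by
    have := hc.le
    have := (startState k).isLt
    omega
  -- `W` is not assumed to be a subset of the database, since determinism concerns all valuations.
  have e1 : ∀ W, gateEval G W C.out = φ (satisfied (W ∩ l.toFinset)) := fun W => by
    rw [← h3 _ Finset.inter_subset_right, h1.eval_inter, hG', gateEval_append _ _ _ h2]
  have e2 : ∀ W, gateEval G W o = decide ((satisfied (W ∩ l.toFinset)).erase i = ν) := fun W => by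
    rw [← accepts_readOrder i ν l _ Finset.inter_subset_right, ho, hc.eval]
    simp only [Finset.mem_inter, Bool.decide_and]
  have hdisj : ∀ μ, ¬ (φ μ = true ∧ decide (μ.erase i = ν) = true) := by
    rintro μ ⟨h1, h2⟩
    rcases (erase_eq_iff hi).1 (of_decide_eq_true h2) with rfl | rfl
    · rw [hν] at h1; cases h1
    · rw [hν'] at h1; cases h1
  have d : DDGates l.toFinset (G ++ [.or [C.out, o]]) := by
    refine hc.dd.append _ ?_ ?_ ?_ ?_
    · simp only [List.mem_singleton]
      rintro _ rfl j hj
      simp only [Gate.inputs, List.mem_cons, List.not_mem_nil, or_false] at hj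
      omega
    · simp
    · simp only [List.mem_singleton, Gate.or.injEq]
      rintro _ rfl j₁ hj₁ j₂ hj₂ hne W ⟨hw1, hw2⟩
      simp only [List.mem_cons, List.not_mem_nil, or_false] at hj₁ hj₂
      rcases hj₁ with rfl | rfl <;> rcases hj₂ with rfl | rfl
      · exact hne rfl
      · exact hdisj _ ⟨e1 W ▸ hw1, e2 W ▸ hw2⟩
      · exact hdisj _ ⟨e1 W ▸ hw2, e2 W ▸ hw1⟩
      · exact hne rfl
    · simp
  have g : (G ++ [Gate.or [C.out, o]])[G.length]? = some (.or [C.out, o]) := by simp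
  refine ⟨d, ?_, fun W hW => ?_⟩
  · change G.length < (G ++ [Gate.or [C.out, o]]).length
    simp
  · change gateEval (G ++ [Gate.or [C.out, o]]) W G.length = _
    rw [d.eval_eq g]
    simp only [Gate.value, List.any_cons, List.any_nil, Bool.or_false]
    rw [gateEval_append _ _ _ (by omega), gateEval_append _ _ _ hlo, e1, e2,
      Finset.inter_eq_left.2 hW]

theorem size_notCircuit (C : Circuit (Fact k)) : (notCircuit C).size = C.size + 2 := by
  change gatesSize (C.gates ++ [Gate.not C.out]) = gatesSize C.gates + 2
  rw [gatesSize_append]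
  simp [gatesSize, Gate.inputs]

theorem size_addCircuit_le (i : Fin (k + 1)) (ν : Finset (Fin (k + 1))) (l : List (Fact k))
    (C : Circuit (Fact k)) :
    (addCircuit i ν l C).size ≤ C.size + 3 * numStates k +
      2 * ((2 * l.length) * ((2 * l.length) * k + 1)) * (3 * (2 + 3 * numStates k)) + 3 := by
  change gatesSize (pairGates i ν l C.gates ++ [Gate.or [C.out, _]]) ≤ gatesSize C.gates + _ + _ + _
  rw [gatesSize_append]
  have h1 := gatesSize_automatonGates (fun t : Fact k => delta i t.kind) (accepts ν)
    l.toFinset (readOrder i l) C.gates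
  have h2 : (readOrder i l).length ≤ 2 * ((2 * l.length) * ((2 * l.length) * k + 1)) := by
    refine (length_factOrder_le i (listConsts l)).trans ?_
    have := length_listConsts_le l
    gcongr
  have h3 : (readOrder i l).length * (3 * (2 + 3 * numStates k)) ≤
    2 * ((2 * l.length) * ((2 * l.length) * k + 1)) * (3 * (2 + 3 * numStates k)) :=
    Nat.mul_le_mul_right _ h2
  have h4 : ∀ a b : ℕ, gatesSize [(Gate.or [a, b] : Gate (Fact k))] = 3 := fun a b => rfl
  rw [h4, pairGates]
  omega

theorem ddpSize_of_eul_eq {φ φ' : BoolFun (Fin (k + 1))} (h : eul φ = eul φ')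
    (hφ : DDPsize (hQuery φ)) : DDPsize (hQuery φ') := by
  refine eul_induction (P := fun φ => DDPsize (hQuery φ)) ?_ ?_ φ φ' h hφ
  · rintro φ ⟨b, hb⟩
    refine ⟨b + 2, fun D => ?_⟩
    obtain ⟨C, h1, h2, h3⟩ := hb D
    obtain ⟨h4, h5⟩ := IsDDFor.notCircuit ⟨h1, h2⟩
    refine ⟨_, h4, h5, ?_⟩
    rw [size_notCircuit]
    simpa using h3
  · rintro φ ν i hi hν hν' ⟨b, hb⟩
    refine ⟨b + .C (3 * numStates k) + 2 * ((2 * .X) * ((2 * .X) * .C k + 1)) *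
      .C (3 * (2 + 3 * numStates k)) + 3, fun D => ?_⟩
    obtain ⟨C, h1, h2, h3⟩ := hb D
    have hD : D.toList.toFinset = D := Finset.toList_toFinset D
    have h0 : IsDDFor φ D.toList.toFinset C := by rw [hD]; exact ⟨h1, h2⟩
    have h45 := h0.addCircuit hi hν hν'
    obtain ⟨h4, h5⟩ := h45
    rw [hD] at h5
    refine ⟨_, h4, h5, (size_addCircuit_le i ν D.toList C).trans ?_⟩
    rw [Finset.length_toList]
    simp only [Polynomial.eval_add, Polynomial.eval_mul, Polynomial.eval_X, Polynomial.eval_C,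
      Polynomial.eval_one, Polynomial.eval_ofNat]
    omega

end PairQueries

/-! ### Computing the circuits -/

section Programs

variable {k : ℕ} {X A B : Type} [Enc X] [Enc A] [Enc B] {Os : Set (Val → Val)}

/-- Programs see only codes, so the type of the result can be changed freely. Facts, gates and
circuits are built from pairs and lists in this way. -/
theorem PT.congr_enc {C : Type} [Enc C] {f : A → B} {g : A → C} (hf : PT Os f)
    (h : ∀ a, enc (g a) = enc (f a)) : PT Os g := by
  obtain ⟨p, b, hp⟩ := hf
  refine ⟨p, b, fun O hO a => ?_⟩
  rw [h]
  exact hp O hO a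

theorem PT.ofFn {m : ℕ} {f : X → Fin m → A} (hf : ∀ s, PT Os (fun x => f x s)) :
    PT Os (fun x => List.ofFn (f x)) := (PT.pi hf).congr_enc fun _ => rfl

instance : Enc Val := ⟨fun v => v⟩

instance : Enc (Fact k) := ⟨encFact⟩

instance : Enc (Gate (Fact k)) := ⟨encGate⟩

instance : Enc (Circuit (Fact k)) := ⟨encCircuit⟩

theorem enc_val_injective : Function.Injective (enc : Val → Val) := fun _ _ h => h

theorem enc_fact_injective : Function.Injective (enc : Fact k → Val) := by
  intro t t' h
  change encFact t = encFact t' at h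
  cases t <;> cases t' <;> simp_all [encFact, Fin.ext_iff]

theorem PT.valFst {f : X → Val} (hf : PT Os f) : PT Os (fun x => (f x).fst) := by
  refine PT.comp (g := fun v : Val => v.fst) (.of_op .fst (fun _ => rfl)
    (polySized_of_le fun v => ?_)) hf
  cases v <;> simp only [sz, enc, Val.fst, Val.size]
  · simp
  · omega

theorem PT.valSnd {f : X → Val} (hf : PT Os f) : PT Os (fun x => (f x).snd) := by
  refine PT.comp (g := fun v : Val => v.snd) (.of_op .snd (fun _ => rfl)
    (polySized_of_le fun v => ?_)) hf
  cases v <;> simp only [sz, enc, Val.snd, Val.size]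
  · simp
  · omega

theorem PT.factVal {t : X → Fact k} (ht : PT Os t) : PT Os (fun x => encFact (t x)) :=
  ht.congr_enc fun _ => rfl

theorem PT.valEq {f : X → Val} (hf : PT Os f) (v : Val) : PT Os (fun x => decide (f x = v)) :=
  PT.eqTest enc_val_injective hf (.const v)

theorem PT.kindEq {t : X → Fact k} (ht : PT Os t) (c : Option (Fin k)) :
    PT Os (fun x => decide ((t x).kind = c)) := by
  have h1 : PT Os (fun x => decide ((encFact (t x)).fst = .nat 1)) := ht.factVal.valFst.valEq _
  cases c with
  | none =>
    refine h1.not.congr fun x => ?_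
    cases t x <;> simp [Fact.kind, encFact, Val.fst]
  | some j =>
    refine (h1.and (ht.factVal.valSnd.valFst.valEq (.nat j))).congr fun x => ?_
    cases t x <;> simp [Fact.kind, encFact, Val.fst, Val.snd, Fin.ext_iff]

theorem PT.consts {t : X → Fact k} (ht : PT Os t) : PT Os (fun x => (t x).consts) := by
  have h := (ht.factVal.valFst.valEq (.nat 1)).ite
    (ht.factVal.valSnd.valSnd.valFst.cons ht.factVal.valSnd.valSnd.valSnd.singleton)
    ht.factVal.valSnd.singleton
  refine h.congr_enc fun x => ?_
  cases t x <;> rfl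

theorem PT.factR {f : X → ℕ} (hf : PT Os f) : PT Os (fun x => (Fact.R (f x) : Fact k)) :=
  ((PT.const 0).pair hf : PT Os fun x => ((0 : ℕ), f x)).congr_enc fun _ => rfl

theorem PT.factT {f : X → ℕ} (hf : PT Os f) : PT Os (fun x => (Fact.T (f x) : Fact k)) :=
  ((PT.const 2).pair hf : PT Os fun x => ((2 : ℕ), f x)).congr_enc fun _ => rfl

theorem PT.factS (j : Fin k) {f g : X → ℕ} (hf : PT Os f) (hg : PT Os g) :
    PT Os (fun x => Fact.S j (f x) (g x)) :=
  ((PT.const 1).pair ((PT.const j.val).pair (hf.pair hg)) :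
    PT Os fun x => ((1 : ℕ), (j.val, (f x, g x)))).congr_enc fun _ => rfl

theorem PT.gateVar {t : X → Fact k} (ht : PT Os t) : PT Os (fun x => Gate.var (t x)) :=
  ((PT.const 0).pair ht : PT Os fun x => ((0 : ℕ), t x)).congr_enc fun _ => rfl

theorem PT.gateNot {f : X → ℕ} (hf : PT Os f) :
    PT Os (fun x => (Gate.not (f x) : Gate (Fact k))) :=
  ((PT.const 1).pair hf : PT Os fun x => ((1 : ℕ), f x)).congr_enc fun _ => rfl

theorem PT.gateAnd {f : X → List ℕ} (hf : PT Os f) :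
    PT Os (fun x => (Gate.and (f x) : Gate (Fact k))) :=
  ((PT.const 2).pair hf : PT Os fun x => ((2 : ℕ), f x)).congr_enc fun _ => rfl

theorem PT.gateOr {f : X → List ℕ} (hf : PT Os f) :
    PT Os (fun x => (Gate.or (f x) : Gate (Fact k))) :=
  ((PT.const 3).pair hf : PT Os fun x => ((3 : ℕ), f x)).congr_enc fun _ => rfl

theorem PT.circuit {G : X → List (Gate (Fact k))} {o : X → ℕ} (hG : PT Os G) (ho : PT Os o) :
    PT Os (fun x => (⟨G x, o x⟩ : Circuit (Fact k))) := (hG.pair ho).congr_enc fun _ => rfl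

theorem PT.gates {C : X → Circuit (Fact k)} (hC : PT Os C) : PT Os (fun x => (C x).gates) :=
  (hC.congr_enc (g := fun x => ((C x).gates, (C x).out)) fun _ => rfl).fst

theorem PT.out {C : X → Circuit (Fact k)} (hC : PT Os C) : PT Os (fun x => (C x).out) :=
  (hC.congr_enc (g := fun x => ((C x).gates, (C x).out)) fun _ => rfl).snd

theorem PT.listConsts {l : X → List (Fact k)} (hl : PT Os l) :
    PT Os (fun x => listConsts (l x)) :=
  .dedupFold enc_nat_injective (hl.flatMap (f := fun _ t => t.consts) PT.id.snd.consts)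

theorem PT.factOrder (i : Fin (k + 1)) {l : X → List ℕ} (hl : PT Os l) :
    PT Os (fun x => factOrder i (l x)) := by
  have hl1 : PT Os (fun q : X × ℕ => l q.1) := hl.comp PT.id.fst
  refine (hl.flatMap (f := fun x a => Fact.R a ::
      (l x).flatMap fun b => List.ofFn fun t => .S (upIndex i t) a b) ?_).append
    (hl.flatMap (f := fun x b => Fact.T b ::
      (l x).flatMap fun a => List.ofFn fun t => .S (downIndex i t) a b) ?_)
  · exact PT.id.snd.factR.cons (hl1.flatMap
      (f := fun (q : X × ℕ) b => List.ofFn fun t => Fact.S (upIndex i t) q.2 b)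
      (.ofFn fun s => .factS _ PT.id.fst.snd PT.id.snd))
  · exact PT.id.snd.factT.cons (hl1.flatMap
      (f := fun (q : X × ℕ) a => List.ofFn fun t => Fact.S (downIndex i t) a q.2)
      (.ofFn fun s => .factS _ PT.id.snd PT.id.fst.snd))

theorem PT.readOrder (i : Fin (k + 1)) {l : X → List (Fact k)} (hl : PT Os l) :
    PT Os (fun x => readOrder i (l x)) := hl.listConsts.factOrder i

/-- The transition table is finite and independent of the input, so it enters the program as
constants, after a case distinction on the kind of the fact. -/
theorem PT.stepLayer {m : ℕ} (δ : Option (Fin k) → Fin m → Bool → Fin m) {present : X → Bool}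
    {n : X → ℕ} {t : X → Fact k} (hp : PT Os present) (hn : PT Os n) (ht : PT Os t) :
    PT Os (fun x => stepLayer (δ (t x).kind) (present x) (n x) (t x)) := by
  refine .finCases (kind := fun x => (t x).kind)
    (f := fun c x => HQ.stepLayer (δ c) (present x) (n x) (t x)) (fun c => ht.kindEq c) fun c => ?_
  exact (hp.ite ht.gateVar (.const _)).cons (hn.gateNot.cons
    ((PT.ofFn fun s => (hn.cons ((hn.sub (.const m)).add (.const _)).singleton).gateAnd).append
      ((PT.ofFn fun s => ((hn.add (.const 1)).cons
          ((hn.sub (.const m)).add (.const _)).singleton).gateAnd).append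
        (PT.ofFn fun s => (((hn.add (.const 2)).add (.const _)).cons
          (((hn.add (.const 2)).add (.const m)).add (.const _)).singleton).gateOr))))

theorem PT.pairGates (i : Fin (k + 1)) (ν : Finset (Fin (k + 1))) {l : X → List (Fact k)}
    {G : X → List (Gate (Fact k))} (hl : PT Os l) (hG : PT Os G) :
    PT Os (fun x => pairGates i ν (l x) (G x)) := by
  refine PT.foldl_append (W := 2 + 3 * numStates k) (l := fun x => (HQ.readOrder i (l x)).reverse)
    (s := fun x => G x ++ acceptLayer (accepts ν))
    (block := fun x n t => HQ.stepLayer (delta i t.kind) (decide (t ∈ (l x).toFinset)) n t)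
    (hl.readOrder i).reverse (hG.append (.const _)) ?_ (fun x n t => (length_stepLayer _ _ _ _).le)
  refine PT.stepLayer (delta i) ?_ PT.id.snd.fst PT.id.snd.snd
  exact (PT.mem enc_fact_injective PT.id.snd.snd (hl.comp PT.id.fst)).congr fun x => by simp

theorem PT.notCircuit {C : X → Circuit (Fact k)} (hC : PT Os C) :
    PT Os (fun x => notCircuit (C x)) :=
  .circuit (hC.gates.append hC.out.gateNot.singleton) hC.gates.length

theorem PT.addCircuit (i : Fin (k + 1)) (ν : Finset (Fin (k + 1))) {l : X → List (Fact k)}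
    {C : X → Circuit (Fact k)} (hl : PT Os l) (hC : PT Os C) :
    PT Os (fun x => addCircuit i ν (l x) (C x)) := by
  have hG := PT.pairGates i ν hl hC.gates
  exact .circuit (hG.append (hC.out.cons
    ((hG.length.sub (.const _)).add (.const _)).singleton).gateOr.singleton) hG.length

/-- The lists of facts without repetitions. -/
abbrev FactList (k : ℕ) := {l : List (Fact k) // l.Nodup}

instance : Enc (FactList k) := ⟨fun l => enc l.1⟩

/-- Choosing one circuit per enumeration turns the definition into a statement about a function, to
which the closure properties of `PT` apply. -/
theorem ddpTime_iff (φ : BoolFun (Fin (k + 1))) : DDPtime (hQuery φ) ↔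
    ∃ C : FactList k → Circuit (Fact k), PT {noOracle} C ∧
      ∀ l, IsDDFor φ l.1.toFinset (C l) := by
  constructor
  · rintro ⟨p, b, h⟩
    choose C h1 h2 h3 using fun l : FactList k => h l.1.toFinset l.1 ⟨l.2, rfl⟩
    refine ⟨C, ⟨p, b, ?_⟩, fun l => ⟨h1 l, h2 l⟩⟩
    rintro O rfl l
    exact h3 l
  · rintro ⟨C, ⟨p, b, h⟩, hC⟩
    refine ⟨p, b, ?_⟩
    rintro D l ⟨hl, rfl⟩
    exact ⟨C ⟨l, hl⟩, (hC ⟨l, hl⟩).1, (hC ⟨l, hl⟩).2, h noOracle rfl ⟨l, hl⟩⟩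

theorem ddpTime_of_eul_eq {φ φ' : BoolFun (Fin (k + 1))} (h : eul φ = eul φ')
    (hφ : DDPtime (hQuery φ)) : DDPtime (hQuery φ') := by
  rw [ddpTime_iff] at hφ ⊢
  refine eul_induction (P := fun φ => ∃ C : FactList k → Circuit (Fact k), PT {noOracle} C ∧
      ∀ l, IsDDFor φ l.1.toFinset (C l)) ?_ ?_ φ φ' h hφ
  · rintro φ ⟨C, hC, h⟩
    exact ⟨_, hC.notCircuit, fun l => (h l).notCircuit⟩
  · rintro φ ν i hi hν hν' ⟨C, hC, h⟩
    have hl : PT {noOracle} (fun l : FactList k => l.1) := .of_enc_eq fun _ => rfl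
    exact ⟨_, hl.addCircuit i ν hC, fun l => (h l).addCircuit hi hν hν'⟩

end Programs

/-! ### Probabilities -/

section Probability

variable {k : ℕ}

/-- The probability that an automaton accepts when it reads the facts of a list, which are true
independently with the probabilities given by `p`. -/
def acceptProb {m : ℕ} (p : Fact k → ℚ) (δ : Fact k → Fin m → Bool → Fin m) (acc : Fin m → Bool) :
    List (Fact k) → Fin m → ℚ
  | [], s => if acc s then 1 else 0
  | t :: L, s => p t * acceptProb p δ acc L (δ t s true) +
      (1 - p t) * acceptProb p δ acc L (δ t s false)

/-- Conditioning on the first fact splits the worlds according to whether they contain it. As it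
does not recur, the rest of the run is unaffected by its membership. -/
theorem acceptProb_eq_sum {m : ℕ} (p : Fact k → ℚ) (δ : Fact k → Fin m → Bool → Fin m)
    (acc : Fin m → Bool) {L : List (Fact k)} (hL : L.Nodup) (s : Fin m) :
    acceptProb p δ acc L s = ∑ W ∈ L.toFinset.powerset,
      ((∏ t ∈ W, p t) * ∏ t ∈ L.toFinset \ W, (1 - p t)) *
        if acc (L.foldl (fun s t => δ t s (decide (t ∈ W))) s) then 1 else 0 := by
  induction L generalizing s with
  | nil => cases h : acc s <;> simp [acceptProb, h]
  | cons t L ih =>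
    rw [List.nodup_cons] at hL
    have ht : t ∉ L.toFinset := by simpa using hL.1
    rw [acceptProb, ih hL.2, ih hL.2, List.toFinset_cons, Finset.sum_powerset_insert ht, add_comm,
      Finset.mul_sum, Finset.mul_sum]
    congr 1 <;> refine Finset.sum_congr rfl fun W hW => ?_
    · have htW : t ∉ W := fun h => ht (Finset.mem_powerset.1 hW h)
      have h1 : insert t L.toFinset \ W = insert t (L.toFinset \ W) :=
        Finset.insert_sdiff_of_notMem _ htW
      rw [h1, Finset.prod_insert (by simp [ht]), List.foldl_cons, decide_eq_false htW]
      ring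
    · have htW : t ∉ W := fun h => ht (Finset.mem_powerset.1 hW h)
      have h1 : insert t L.toFinset \ insert t W = L.toFinset \ W := by
        rw [Finset.insert_sdiff_insert, Finset.sdiff_insert_of_notMem ht]
      have h2 : ∀ s, L.foldl (fun s t' => δ t' s (decide (t' ∈ insert t W))) s =
          L.foldl (fun s t' => δ t' s (decide (t' ∈ W))) s := fun s =>
        List.foldl_ext _ _ _ fun s t' ht' => by
          have : t' ≠ t := fun e => hL.1 (e ▸ ht')
          simp [this]
      rw [h1, Finset.prod_insert htW, List.foldl_cons, h2, decide_eq_true (Finset.mem_insert_self t W)]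
      ring

/-! ### Probabilities of the queries as sums over worlds. -/

namespace TID

theorem worldProb_nonneg (I : TID k) {W : Database k} (hW : W ⊆ I.D) : 0 ≤ I.worldProb W := by
  refine mul_nonneg (Finset.prod_nonneg fun t ht => I.nonneg t (hW ht))
    (Finset.prod_nonneg fun t ht => ?_)
  have := I.le_one t (Finset.mem_sdiff.1 ht).1
  linarith

/-- Expand the product of the factors `π t + (1 - π t)`. -/
theorem sum_worldProb (I : TID k) : ∑ W ∈ I.D.powerset, I.worldProb W = 1 := by
  have h := Finset.prod_add (fun t => I.π t) (fun t => 1 - I.π t) I.D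
  simp only [add_sub_cancel, Finset.prod_const_one] at h
  exact h.symm

theorem prob_hQuery (I : TID k) (φ : BoolFun (Fin (k + 1))) :
    I.prob (hQuery φ) = ∑ W ∈ I.D.powerset, I.worldProb W * if φ (satisfied W) then 1 else 0 := by
  rw [TID.prob, Finset.sum_filter]
  refine Finset.sum_congr rfl fun W _ => ?_
  simp [hQuery_iff]

theorem prob_nonneg (I : TID k) (φ : BoolFun (Fin (k + 1))) : 0 ≤ I.prob (hQuery φ) := by
  rw [prob_hQuery]
  refine Finset.sum_nonneg fun W hW => mul_nonneg (I.worldProb_nonneg (Finset.mem_powerset.1 hW)) ?_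
  split_ifs <;> norm_num

theorem prob_not (I : TID k) (φ : BoolFun (Fin (k + 1))) :
    I.prob (hQuery fun ν => !φ ν) = 1 - I.prob (hQuery φ) := by
  rw [prob_hQuery, prob_hQuery, eq_sub_iff_add_eq]
  refine (Finset.sum_add_distrib.symm.trans ?_).trans I.sum_worldProb
  refine Finset.sum_congr rfl fun W _ => ?_
  cases φ (satisfied W) <;> simp

theorem prob_le_one (I : TID k) (φ : BoolFun (Fin (k + 1))) : I.prob (hQuery φ) ≤ 1 := by
  have h1 := I.prob_not φ
  have h2 := I.prob_nonneg fun ν => !φ ν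
  linarith

theorem prob_or (I : TID k) (φ ψ : BoolFun (Fin (k + 1)))
    (h : ∀ ν, ¬ (φ ν = true ∧ ψ ν = true)) :
    I.prob (hQuery fun ν => φ ν || ψ ν) = I.prob (hQuery φ) + I.prob (hQuery ψ) := by
  rw [prob_hQuery, prob_hQuery, prob_hQuery, ← Finset.sum_add_distrib]
  refine Finset.sum_congr rfl fun W _ => ?_
  have := h (satisfied W)
  cases h1 : φ (satisfied W) <;> cases h2 : ψ (satisfied W) <;> simp_all

/-- The probabilities, extended by zero. -/
def extProb (I : TID k) (t : Fact k) : ℚ := if t ∈ I.D then I.π t else 0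

/-- Facts that are read but absent from `I.D` get probability `0`. Worlds that contain one have
weight `0`, and in the others they contribute the factor `1`. -/
theorem prob_pair (I : TID k) (i : Fin (k + 1)) (ν : Finset (Fin (k + 1))) {l : List (Fact k)}
    (hl : l.toFinset = I.D) :
    I.prob (hQuery fun μ => decide (μ.erase i = ν)) =
      acceptProb I.extProb (fun t => delta i t.kind) (accepts ν) (readOrder i l) (startState k) := by
  rw [prob_hQuery, acceptProb_eq_sum _ _ _ (nodup_readOrder i l)]
  have hsub : I.D ⊆ (readOrder i l).toFinset := fun t ht =>
    List.mem_toFinset.2 (mem_readOrder i (List.mem_toFinset.1 (hl ▸ ht)))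
  symm
  refine (Finset.sum_subset (Finset.powerset_mono.2 hsub) fun W _ hW => ?_).symm.trans
    (Finset.sum_congr rfl fun W hW => ?_)
  · rw [Finset.mem_powerset, Finset.not_subset] at hW
    obtain ⟨t, ht, htD⟩ := hW
    rw [Finset.prod_eq_zero ht (by simp [extProb, htD]), zero_mul, zero_mul]
  · rw [Finset.mem_powerset] at hW
    rw [accepts_readOrder i ν l W (hl ▸ hW), worldProb]
    have h1 : ∏ t ∈ W, I.extProb t = ∏ t ∈ W, I.π t :=
      Finset.prod_congr rfl fun t ht => by simp [extProb, hW ht]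
    have h2 : ∏ t ∈ (readOrder i l).toFinset \ W, (1 - I.extProb t) =
        ∏ t ∈ I.D \ W, (1 - I.π t) := by
      rw [← Finset.prod_subset (Finset.sdiff_subset_sdiff hsub le_rfl) fun t ht ht' => ?_]
      · exact Finset.prod_congr rfl fun t ht => by
          simp [extProb, (Finset.mem_sdiff.1 ht).1]
      · simp only [Finset.mem_sdiff] at ht ht'
        have : t ∉ I.D := fun h => ht' ⟨h, ht.2⟩
        simp [extProb, this]
    rw [h1, h2]

/-- A common denominator of the probabilities of the worlds. -/
def denom (I : TID k) : ℕ := ∏ t ∈ I.D, (I.π t).den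

/-- Multiplying the weight of a world by `denom` gives a product of the integers `π t * den` and `(1
- π t) * den`. One denominator thus serves all of the exponentially many worlds. -/
theorem den_prob_dvd (I : TID k) (Q : BoolQuery k) : (I.prob Q).den ∣ I.denom := by
  have hint : I.prob Q * I.denom ∈ (Int.castRingHom ℚ).range := by
    classical
    rw [TID.prob, Finset.sum_mul]
    refine Subring.sum_mem _ fun W hW => ?_
    have hW' := Finset.mem_powerset.1 (Finset.mem_filter.1 hW).1
    have hd : (I.denom : ℚ) = (∏ t ∈ W, ((I.π t).den : ℚ)) * ∏ t ∈ I.D \ W, ((I.π t).den : ℚ) := by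
      rw [mul_comm, Finset.prod_sdiff hW', denom]
      push_cast
      rfl
    have he : I.worldProb W * I.denom = (∏ t ∈ W, I.π t * (I.π t).den) *
        ∏ t ∈ I.D \ W, (1 - I.π t) * (I.π t).den := by
      rw [worldProb, hd, Finset.prod_mul_distrib, Finset.prod_mul_distrib]
      ring
    rw [he]
    refine Subring.mul_mem _ (Subring.prod_mem _ fun t _ => ?_) (Subring.prod_mem _ fun t _ => ?_)
    · exact ⟨(I.π t).num, by simp [Rat.mul_den_eq_num]⟩
    · exact ⟨(I.π t).den - (I.π t).num, by simp [sub_mul, Rat.mul_den_eq_num]⟩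
  obtain ⟨z, hz⟩ := hint
  have hpos : (I.denom : ℚ) ≠ 0 := by
    rw [denom]
    push_cast
    exact Finset.prod_ne_zero_iff.2 fun t _ => by exact_mod_cast (I.π t).den_nz
  have hq : I.prob Q = Rat.divInt z (I.denom : ℤ) := by
    rw [Rat.divInt_eq_div, eq_div_iff (by exact_mod_cast hpos)]
    simpa using hz.symm
  have := Rat.den_dvd z (I.denom : ℤ)
  rw [← hq] at this
  exact_mod_cast this

end TID

theorem num_toNat_le_den {q : ℚ} (h : q ≤ 1) : q.num.toNat ≤ q.den := by
  have := Rat.num_le_denom_iff.2 h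
  omega

theorem num_toNat_div_den {q : ℚ} (h : 0 ≤ q) : (q.num.toNat : ℚ) / q.den = q := by
  have h1 : ((q.num.toNat : ℤ) : ℚ) = q.num := by
    rw [Int.toNat_of_nonneg (Rat.num_nonneg.2 h)]
  conv_rhs => rw [← Rat.num_div_den q]
  rw [← h1]
  rfl

/-! ### Computing the probabilities -/

/-- Tuple-independent databases with an enumeration of their facts. -/
abbrev TIDList (k : ℕ) := {x : TID k × List (Fact k) // Lists x.2 x.1.D}

instance : Enc (TIDList k) := ⟨fun x => encTID x.1.2 x.1.1.π⟩

/-- The facts with their probabilities. -/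
def TIDList.pairs (x : TIDList k) : List (Fact k × ℚ) := x.1.2.map fun t => (t, x.1.1.π t)

variable {Os : Set (Val → Val)}

theorem TIDList.enc_pairs (x : TIDList k) : enc x.pairs = enc x := by
  change encList ((x.1.2.map _).map _) = encList _
  rw [List.map_map]
  rfl

theorem TIDList.sz_pairs (x : TIDList k) : sz x.pairs = sz x := by
  unfold sz; rw [x.enc_pairs]

theorem TIDList.mem_iff (x : TIDList k) (t : Fact k) : t ∈ x.1.2 ↔ t ∈ x.1.1.D := by
  rw [← x.2.2, List.mem_toFinset]

theorem PT.tidPairs : PT Os (fun x : TIDList k => x.pairs) := .of_enc_eq fun x => x.enc_pairs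

theorem PT.tidFacts : PT Os (fun x : TIDList k => x.1.2) :=
  ((PT.tidPairs (k := k) (Os := Os)).map (f := fun _ y => y.1) PT.id.snd.fst).congr fun x => by
    rw [TIDList.pairs, List.map_map]
    exact (List.map_id _).symm

/-- Numerator and denominator of the probability of a fact, extended by zero. -/
def TIDList.fraction (x : TIDList k) (t : Fact k) : ℕ × ℕ :=
  if t ∈ x.1.2 then ((x.1.1.π t).num.toNat, (x.1.1.π t).den) else (0, 1)

theorem sz_fraction_le (q : ℚ) : sz (q.num.toNat, q.den) ≤ sz q := by
  change (Val.pair (.nat _) (.nat _)).size ≤ (Val.pair (.pair (.nat _) (.nat _)) (.nat _)).size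
  simp only [Val.size]
  omega

theorem TIDList.size_fraction_le (x : TIDList k) (t : Fact k) :
    Nat.size (x.fraction t).2 ≤ sz x := by
  rw [TIDList.fraction]
  split_ifs with h
  · have h1 := sz_fraction_le (x.1.1.π t)
    have h2 : (t, x.1.1.π t) ∈ x.pairs := List.mem_map.2 ⟨t, h, rfl⟩
    have h3 := sz_le_of_mem h2
    rw [x.sz_pairs, sz_prod] at h3
    rw [sz_prod, sz_nat, sz_nat] at h1
    dsimp only
    omega
  · simpa using one_le_sz x

theorem TIDList.fraction_le (x : TIDList k) (t : Fact k) :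
    (x.fraction t).1 ≤ (x.fraction t).2 ∧ 0 < (x.fraction t).2 := by
  rw [TIDList.fraction]
  split_ifs with h
  · exact ⟨num_toNat_le_den (x.1.1.le_one t ((x.mem_iff t).1 h)), (x.1.1.π t).den_pos⟩
  · simp

theorem TIDList.fraction_eq (x : TIDList k) (t : Fact k) :
    ((x.fraction t).1 : ℚ) / (x.fraction t).2 = x.1.1.extProb t := by
  rw [TIDList.fraction, TID.extProb]
  by_cases h : t ∈ x.1.2
  · have h' := (x.mem_iff t).1 h
    rw [if_pos h, if_pos h']
    exact num_toNat_div_den (x.1.1.nonneg t h')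
  · rw [if_neg h, if_neg fun h' => h ((x.mem_iff t).2 h')]
    simp

theorem PT.fraction {X : Type} [Enc X] {x : X → TIDList k} {t : X → Fact k} (hx : PT Os x)
    (ht : PT Os t) : PT Os (fun a => (x a).fraction (t a)) := by
  suffices h : PT Os (fun q : TIDList k × Fact k => q.1.fraction q.2) from h.comp (hx.pair ht)
  have h := (PT.tidPairs.comp PT.id.fst : PT Os fun q : TIDList k × Fact k => q.1.pairs).foldl_of_growth
    (s := fun _ => ((0 : ℕ), (1 : ℕ)))
    (step := fun q s y => if decide (y.1 = q.2) then (y.2.num.toNat, y.2.den) else s)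
    (.const _) ((PT.eqTest enc_fact_injective PT.id.snd.snd.fst PT.id.fst.snd).ite
      (PT.id.snd.snd.snd.num.pair PT.id.snd.snd.snd.den) PT.id.snd.fst)
    ⟨.X, fun q s y => by
      rw [Polynomial.eval_X]
      have h1 := sz_fraction_le y.2
      have h2 := sz_prod' y
      split_ifs <;> omega⟩
  refine h.congr fun q => ?_
  have key : ∀ (l : List (Fact k)) (s : ℕ × ℕ), (l.map fun t => (t, q.1.1.1.π t)).foldl
      (fun s y => if decide (y.1 = q.2) then (y.2.num.toNat, y.2.den) else s) s =
      if q.2 ∈ l then ((q.1.1.1.π q.2).num.toNat, (q.1.1.1.π q.2).den) else s := fun l => by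
    induction l with
    | nil => simp
    | cons t l ih =>
      intro s
      rw [List.map_cons, List.foldl_cons, ih]
      by_cases h1 : t = q.2
      · simp [h1]
      · simp [h1, Ne.symm h1]
  rw [TIDList.pairs, key]
  rfl

section Table

variable {m : ℕ}

/-- One step of the computation of the acceptance probabilities from all states, represented by
numerators and a common denominator. -/
def tableStep (δ : Fin m → Bool → Fin m) (f : ℕ × ℕ) (N : (Fin m → ℕ) × ℕ) : (Fin m → ℕ) × ℕ :=
  (fun s => f.1 * N.1 (δ s true) + (f.2 - f.1) * N.1 (δ s false), f.2 * N.2)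

/-- The table for the empty list of facts. -/
def tableInit (acc : Fin m → Bool) : (Fin m → ℕ) × ℕ := (fun s => if acc s then 1 else 0, 1)

theorem tableStep_le (δ : Fin m → Bool → Fin m) {f : ℕ × ℕ} (hf : f.1 ≤ f.2)
    {N : (Fin m → ℕ) × ℕ} (hN : ∀ s, N.1 s ≤ N.2) (s : Fin m) :
    (tableStep δ f N).1 s ≤ (tableStep δ f N).2 := by
  obtain ⟨c, hc⟩ := Nat.exists_eq_add_of_le hf
  simp only [tableStep, hc, Nat.add_sub_cancel_left, add_mul]
  exact add_le_add (Nat.mul_le_mul_left _ (hN _)) (Nat.mul_le_mul_left _ (hN _))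

/-- No fractions are reduced during the computation. The numerators stay below the common
denominator, whose bit length grows by at most `sz x` per fact; this is the prefix bound required by
`PT.foldl`. -/
theorem table_bounds (δ : Fact k → Fin m → Bool → Fin m) (acc : Fin m → Bool) (x : TIDList k)
    (L : List (Fact k)) :
    let N := L.foldl (fun N t => tableStep (δ t) (x.fraction t) N) (tableInit acc)
    (∀ s, N.1 s ≤ N.2) ∧ Nat.size N.2 ≤ 1 + L.length * sz x := by
  induction L using List.reverseRecOn with
  | nil =>
    refine ⟨fun s => ?_, by simp [tableInit]⟩
    simp only [List.foldl_nil, tableInit]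
    split_ifs <;> omega
  | append_singleton L t ih =>
    obtain ⟨h1, h2⟩ := ih
    simp only [List.foldl_append, List.foldl_cons, List.foldl_nil]
    refine ⟨tableStep_le _ (x.fraction_le t).1 h1, ?_⟩
    have h3 := x.size_fraction_le t
    rw [List.length_append, List.length_singleton, add_mul, one_mul, tableStep]
    refine (size_mul_le _ _).trans ?_
    omega

theorem table_correct (δ : Fact k → Fin m → Bool → Fin m) (acc : Fin m → Bool) (x : TIDList k)
    (L : List (Fact k)) :
    let N := L.reverse.foldl (fun N t => tableStep (δ t) (x.fraction t) N) (tableInit acc)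
    0 < N.2 ∧ ∀ s, (N.1 s : ℚ) / N.2 = acceptProb x.1.1.extProb δ acc L s := by
  induction L with
  | nil =>
    refine ⟨by simp [tableInit], fun s => ?_⟩
    simp only [List.reverse_nil, List.foldl_nil, tableInit, acceptProb]
    cases acc s <;> simp
  | cons t L ih =>
    obtain ⟨h1, h2⟩ := ih
    obtain ⟨h3, h4⟩ := x.fraction_le t
    simp only [List.reverse_cons, List.foldl_append, List.foldl_cons, List.foldl_nil]
    refine ⟨Nat.mul_pos h4 h1, fun s => ?_⟩
    rw [acceptProb, ← x.fraction_eq, ← h2, ← h2, tableStep]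
    -- The subtraction in `tableStep` is truncated; `h3` makes it exact.
    push_cast [Nat.cast_sub h3]
    have h1' : ((L.reverse.foldl (fun N t => tableStep (δ t) (x.fraction t) N)
      (tableInit acc)).2 : ℚ) ≠ 0 := by exact_mod_cast h1.ne'
    have h4' : ((x.fraction t).2 : ℚ) ≠ 0 := by exact_mod_cast h4.ne'
    field_simp

theorem PT.table (δ : Option (Fin k) → Fin m → Bool → Fin m) (acc : Fin m → Bool)
    {l : TIDList k → List (Fact k)} (hl : PT Os l) :
    PT Os (fun x => (l x).foldl (fun N t => tableStep (δ t.kind) (x.fraction t) N)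
      (tableInit acc)) := by
  rcases Os.eq_empty_or_nonempty with rfl | hO
  · exact ⟨.oracle, 0, by simp⟩
  obtain ⟨b, hb⟩ := hl.polySized hO
  refine hl.foldl (step := fun x N t => tableStep (δ t.kind) (x.fraction t) N) (.const _) ?_
    ⟨.C m * ((1 + b * .X) + 2) + 1 + (1 + b * .X + 1) + 1, fun x l' hl' => ?_⟩
  · refine .finCases (X := TIDList k × ((Fin m → ℕ) × ℕ) × Fact k) (kind := fun q => q.2.2.kind)
      (f := fun c q => tableStep (δ c) (q.1.fraction q.2.2) q.2.1) (fun c => PT.id.snd.snd.kindEq c)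
      fun c => ?_
    have hf : PT Os (fun q : TIDList k × ((Fin m → ℕ) × ℕ) × Fact k => q.1.fraction q.2.2) :=
      PT.fraction PT.id.fst PT.id.snd.snd
    exact (PT.pi fun s => (hf.fst.mul (PT.id.snd.fst.fst.apply _)).add
      ((hf.snd.sub hf.fst).mul (PT.id.snd.fst.fst.apply _))).pair (hf.snd.mul PT.id.snd.fst.snd)
  · obtain ⟨h1, h2⟩ := table_bounds (fun t => δ t.kind) acc x l'
    set N := l'.foldl (fun N t => tableStep (δ t.kind) (x.fraction t) N) (tableInit acc)
    have h3 : l'.length * sz x ≤ b.eval (sz x) * sz x :=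
      Nat.mul_le_mul_right _ (hl'.length_le.trans ((length_lt_sz _).le.trans (hb x)))
    have h4 : sz N.1 ≤ m * (1 + b.eval (sz x) * sz x + 1 + 1) + 1 := by
      have h5 : sz (List.ofFn N.1) ≤ (List.ofFn N.1).length * _ + 1 :=
        sz_list_le (c := 1 + b.eval (sz x) * sz x + 1) fun n hn => by
          obtain ⟨s, rfl⟩ := (List.mem_ofFn' _ _).1 hn
          have := Nat.size_le_size (h1 s)
          rw [sz_nat]
          omega
      rw [List.length_ofFn] at h5
      exact h5
    rw [sz_prod' N, sz_nat]
    simp only [Polynomial.eval_add, Polynomial.eval_mul, Polynomial.eval_X, Polynomial.eval_C,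
      Polynomial.eval_one, Polynomial.eval_ofNat]
    have h6 : m * (1 + b.eval (sz x) * sz x + 1 + 1) = m * (1 + b.eval (sz x) * sz x + 2) := rfl
    omega

end Table

theorem PT.prob_pair (i : Fin (k + 1)) (ν : Finset (Fin (k + 1))) :
    PT Os (fun x : TIDList k => x.1.1.prob (hQuery fun μ => decide (μ.erase i = ν))) := by
  have h := PT.table (delta i) (accepts ν) (PT.tidFacts (k := k) (Os := Os) |>.readOrder i).reverse
  refine ((h.fst.apply (startState k)).ratDiv h.snd).congr fun x => ?_
  rw [x.1.1.prob_pair i ν x.2.2]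
  exact ((table_correct (fun t => delta i t.kind) (accepts ν) x _).2 _).symm

/-- Nonnegativity is needed because `PT.num` delivers the numerator as a natural number. -/
theorem PT.ratAdd {X : Type} [Enc X] {f g : X → ℚ} (hf : PT Os f) (hg : PT Os g)
    (hf0 : ∀ x, 0 ≤ f x) (hg0 : ∀ x, 0 ≤ g x) : PT Os (fun x => f x + g x) := by
  refine (PT.ratDiv ((hf.num.mul hg.den).add (hf.den.mul hg.num)) (hf.den.mul hg.den)).congr
    fun x => ?_
  conv_lhs => rw [← num_toNat_div_den (hf0 x), ← num_toNat_div_den (hg0 x)]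
  rw [div_add_div _ _ (by exact_mod_cast (f x).den_nz) (by exact_mod_cast (g x).den_nz)]
  push_cast
  rfl

theorem PT.one_sub {X : Type} [Enc X] {f : X → ℚ} (hf : PT Os f)
    (hf0 : ∀ x, 0 ≤ f x) (hf1 : ∀ x, f x ≤ 1) : PT Os (fun x => 1 - f x) := by
  refine (PT.ratDiv (hf.den.sub hf.num) hf.den).congr fun x => ?_
  rw [Nat.cast_sub (num_toNat_le_den (hf1 x)), sub_div, num_toNat_div_den (hf0 x),
    div_self (by exact_mod_cast (f x).den_nz)]

theorem PT.prob_of_eul_eq {φ φ' : BoolFun (Fin (k + 1))} (h : eul φ = eul φ')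
    (hφ : PT Os fun x : TIDList k => x.1.1.prob (hQuery φ)) :
    PT Os fun x : TIDList k => x.1.1.prob (hQuery φ') := by
  refine eul_induction (P := fun φ => PT Os fun x : TIDList k => x.1.1.prob (hQuery φ)) ?_ ?_
    φ φ' h hφ
  · intro φ hφ
    exact (hφ.one_sub (fun x => x.1.1.prob_nonneg φ) fun x => x.1.1.prob_le_one φ).congr
      fun x => x.1.1.prob_not φ
  · intro φ ν i hi hν hν' hφ
    refine (hφ.ratAdd (PT.prob_pair i ν) (fun x => x.1.1.prob_nonneg φ)
      fun x => x.1.1.prob_nonneg _).congr fun x => x.1.1.prob_or φ _ ?_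
    rintro μ ⟨h1, h2⟩
    rcases (erase_eq_iff hi).1 (of_decide_eq_true h2) with rfl | rfl
    · rw [hν] at h1; cases h1
    · rw [hν'] at h1; cases h1

/-! ### The length of the oracle's answers, and the Turing reduction. -/

theorem TIDList.size_denom_le (x : TIDList k) : Nat.size x.1.1.denom ≤ sz x := by
  have key : ∀ l : List (Fact k), Nat.size (l.map fun t => (x.1.1.π t).den).prod ≤
      sz (l.map fun t => (t, x.1.1.π t)) := fun l => by
    induction l with
    | nil => simp [sz_nil]
    | cons t l ih =>
      rw [List.map_cons, List.prod_cons, List.map_cons, sz_cons]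
      have h1 := size_mul_le (x.1.1.π t).den (l.map fun t => (x.1.1.π t).den).prod
      have h2 := sz_fraction_le (x.1.1.π t)
      rw [sz_prod, sz_nat, sz_nat] at h2
      have h3 := sz_prod t (x.1.1.π t)
      omega
  have h := key x.1.2
  rw [← List.prod_toFinset _ x.2.1, x.2.2] at h
  exact h.trans (TIDList.sz_pairs x).le

/-- The caller pays for the length of the oracle's answer. The denominator divides `denom`, and the
numerator is at most the denominator because a probability is at most `1`. -/
theorem TIDList.sz_prob_le (x : TIDList k) (φ : BoolFun (Fin (k + 1))) :
    sz (x.1.1.prob (hQuery φ)) ≤ 2 * sz x + 5 := by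
  set q := x.1.1.prob (hQuery φ) with hq
  have h0 : 0 ≤ q := x.1.1.prob_nonneg φ
  have h1 : q.den ≤ x.1.1.denom := Nat.le_of_dvd
    (Finset.prod_pos fun t _ => (x.1.1.π t).den_pos) (x.1.1.den_prob_dvd _)
  have h2 : q.num.toNat ≤ q.den := num_toNat_le_den (x.1.1.prob_le_one φ)
  have h3 : (-q.num).toNat = 0 := Int.toNat_eq_zero.2 (by have := Rat.num_nonneg.2 h0; omega)
  have h4 := x.size_denom_le
  have h5 := Nat.size_le_size h1
  have h6 := Nat.size_le_size h2
  change (Val.pair (.pair (.nat q.num.toNat) (.nat (-q.num).toNat)) (.nat q.den)).size ≤ _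
  simp only [Val.size, h3, Nat.size_zero]
  omega

theorem pqe_iff (Q : BoolQuery k) (v w : Val) :
    PQE Q v w ↔ ∃ x : TIDList k, v = enc x ∧ w = enc (x.1.1.prob Q) := by
  constructor
  · rintro ⟨I, l, hl, rfl, rfl⟩
    exact ⟨⟨(I, l), hl⟩, rfl, rfl⟩
  · rintro ⟨x, rfl, rfl⟩
    exact ⟨x.1.1, x.1.2, x.2, rfl, rfl⟩

/-- Take for `Os` the set of all oracles that are correct for `φ`. A single call then computes the
probability for `φ`, and `PT.prob_of_eul_eq` turns it into one program for `φ'` that works with all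
these oracles. -/
theorem turingReducible_of_eul_eq {φ φ' : BoolFun (Fin (k + 1))} (h : eul φ = eul φ') :
    TuringReducible (PQE (hQuery φ')) (PQE (hQuery φ)) := by
  have hor : PT {O | ∀ x y, PQE (hQuery φ) x y → O x = y}
      (fun x : TIDList k => x.1.1.prob (hQuery φ)) := by
    refine ⟨.oracle, .X + (2 * .X + 5), fun O hO x => ?_⟩
    have hx : O (enc x) = enc (x.1.1.prob (hQuery φ)) :=
      hO _ _ ((pqe_iff _ _ _).2 ⟨x, rfl, rfl⟩)
    have hr := Runs.oracle (O := O) (enc x)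
    rw [hx] at hr
    refine ⟨_, ?_, hr⟩
    have := x.sz_prob_le φ
    unfold sz at *
    simp only [Polynomial.eval_add, Polynomial.eval_mul, Polynomial.eval_X, Polynomial.eval_ofNat]
    omega
  obtain ⟨p, b, hp⟩ := PT.prob_of_eul_eq h hor
  refine ⟨p, b, fun O hO v w hvw => ?_⟩
  obtain ⟨x, rfl, rfl⟩ := (pqe_iff _ _ _).1 hvw
  exact hp O hO x

end Probability
end HQ

theorem mainTheorem7 (k : ℕ) (hk : 1 ≤ k) (φ φ' : HQ.BoolFun (Fin (k + 1)))
    (heul : HQ.eul φ = HQ.eul φ') :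
    HQ.TuringEquivalent (HQ.PQE (HQ.hQuery φ)) (HQ.PQE (HQ.hQuery φ')) ∧
    (HQ.DDPtime (HQ.hQuery φ) ↔ HQ.DDPtime (HQ.hQuery φ')) ∧
    (HQ.DDPsize (HQ.hQuery φ) ↔ HQ.DDPsize (HQ.hQuery φ')) :=
  ⟨⟨HQ.turingReducible_of_eul_eq heul.symm, HQ.turingReducible_of_eul_eq heul⟩,
    ⟨HQ.ddpTime_of_eul_eq heul, HQ.ddpTime_of_eul_eq heul.symm⟩,
    ⟨HQ.ddpSize_of_eul_eq heul, HQ.ddpSize_of_eul_eq heul.symm⟩⟩
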